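/- **Setting.** There are $N\ge 3$ buyers with unit demand. Their private valuations $X_1,\dots,X_N$ are independent with common distribution $F$, which has support $[\underline x,\bar x]$, $0\le\underline x<\bar x$, and a density $f$ that is continuous on $[\underline x,\bar x]$ and positive on $[\underline x,\bar x)$. The virtual value $\psi(x)=x-\frac{1-F(x)}{f(x)}$ is increasing on $[\underline x,\bar x]$ (with $\psi(\bar x)=\bar x$). Write $x_{(1)}\ge x_{(2)}\ge\dots\ge x_{(N)}$ for the entries of a vector $x$ in decreasing order. A first seller has one unit of a good. Afterwards every buyer who did not get it takes part in a second-price auction, without reserve price, for a second identical unit, and bids his valuation there. Thus a buyer with valuation $v$ who does not get the first unit receives from the second auction $\max\{v-w,0\}$, where $w$ is the highest valuation among the other buyers who did not get the first unit. A direct mechanism for the first seller assigns to each report vector $x\in[\underline x,\bar x]^N$ probabilities $P_i(x)\ge 0$ with $\sum_i P_i(x)\le 1$ (buyer $i$ gets the first unit) and payments $t_i(x)\in\mathbb R$ (measurable in $x$, with finite expectation both ex ante and conditionally on each own report). It is incentive compatible if, for every buyer and every valuation, truthful reporting maximizes his interim expected total payoff (from both sellers, net of $t_i$) when the others report truthfully.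 It is individually rational if, for every buyer $i$ and valuation $x_i$, this truthful payoff is at least $E\max\{x_i-\max_{j\ne i}X_j,0\}$, his expected payoff from the second auction when the first unit is not allocated. A mechanism is optimal if it is incentive compatible and individually rational and maximizes the expected revenue $E\sum_i t_i(X)$ among all such direct mechanisms. For $x\in[\underline x,\bar x]$ let $a(x)=\min\{a\in[\underline x,\bar x]: a\ge x,\ a+\psi(a)\ge x\}$. **Theorem.** The minimum defining $a(x)$ exists, and the following direct mechanism (ties between buyers are broken uniformly at random) is optimal. 1. *Allocation.* The first unit goes to the buyer with the second-highest valuation if $\psi(x_{(2)})+x_{(2)}-x_{(3)}\ge 0$, equivalently $x_{(2)}\ge a(x_{(3)})$, and is not allocated otherwise. 2. *Payments.* (a) If $\psi(x_{(3)})<0$ and the unit is allocated, the buyer with the highest valuation pays $a(x_{(3)})-x_{(3)}>0$, the buyer with the second-highest valuation pays $a(x_{(3)})>0$, and the others pay nothing. (b) If $\psi(x_{(3)})\ge 0$, then $a(x_{(3)})=x_{(3)}$, the unit is allocated, the buyer with the second-highest valuation pays $x_{(3)}>0$, and the others pay nothing. (c) If the unit is not allocated, nobody pays anything. 3. *Revenue.*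 The expected revenue of this mechanism is $E\max\{\psi(X_{(2)})+X_{(2)}-X_{(3)},\,0\}$. -/

import Mathlib

open MeasureTheory ProbabilityTheory Set

noncomputable section

namespace SeqAuction

/-- The virtual valuation `ψ(x) = x - (1 - F(x)) / f(x)`, where `F` is the distribution function
of `μ` and `f` its density. -/
def virtualValue (μ : Measure ℝ) (f : ℝ → ℝ) (x : ℝ) : ℝ :=
  x - (1 - cdf μ x) / f x

/-- The feasible values of `a` in the definition of the threshold `a(x)`:
those `a ∈ [lo, hi]` with `a ≥ x` and `a + ψ(a) ≥ x`. -/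
def thresholdSet (lo hi : ℝ) (μ : Measure ℝ) (f : ℝ → ℝ) (x : ℝ) : Set ℝ :=
  {a | a ∈ Icc lo hi ∧ x ≤ a ∧ x ≤ a + virtualValue μ f a}

/-- The threshold `a(x) = min {a ≥ x : a + ψ(a) ≥ x}`. -/
def threshold (lo hi : ℝ) (μ : Measure ℝ) (f : ℝ → ℝ) (x : ℝ) : ℝ :=
  sInf (thresholdSet lo hi μ f x)

section Buyers

variable {N : ℕ}

/-- The entries of `x` from highest to lowest: `orderStat x 0` is the highest entry,
`orderStat x 1` the second highest, and so on. -/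
def orderStat (x : Fin N → ℝ) (k : Fin N) : ℝ :=
  x (Tuple.sort (fun i => OrderDual.toDual (x i)) k)

/-- All ways to rank the buyers from highest to lowest report (`σ k` is the buyer in position `k`);
there is more than one exactly when there are ties. -/
def rankings (x : Fin N → ℝ) : Finset (Equiv.Perm (Fin N)) :=
  open Classical in Finset.univ.filter fun σ => Antitone fun k => x (σ k)

/-- The joint law of `N` independent valuations, each with law `μ`. -/
def jointLaw (N : ℕ) (μ : Measure ℝ) : Measure (Fin N → ℝ) :=
  Measure.pi fun _ => μ

/-- A direct mechanism: for each vector of reports `x`, the probability `alloc x i` that buyer `i`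
gets the first seller's good, and the payment `pay x i` of buyer `i` to the first seller. -/
structure DirectMechanism (N : ℕ) where
  alloc : (Fin N → ℝ) → Fin N → ℝ
  pay : (Fin N → ℝ) → Fin N → ℝ

/-- Payoff of buyer `i` in a second-price auction without reserve price against the set `S` of
rivals, everyone bidding the valuation `v`: the excess, if positive, of `v i` over the highest rival
valuation (zero if there is no rival). -/
def secondAuctionPayoff (v : Fin N → ℝ) (S : Finset (Fin N)) (i : Fin N) : ℝ :=
  max (v i - S.fold max 0 v) 0

/-- Expected payoff of buyer `i`, before the payment to the first seller, when the valuations are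
`v` and the reports are `b`. If `i` gets the first good, the payoff is `v i`. If another buyer `j`
gets it, then `i` meets all buyers other than `i` and `j` in the second auction. If nobody gets it,
then `i` meets all other buyers there. -/
def DirectMechanism.grossPayoff (M : DirectMechanism N) (v b : Fin N → ℝ) (i : Fin N) : ℝ :=
  M.alloc b i * v i
    + ∑ j ∈ Finset.univ.erase i,
        M.alloc b j * secondAuctionPayoff v ((Finset.univ.erase i).erase j) i
    + (1 - ∑ j, M.alloc b j) * secondAuctionPayoff v (Finset.univ.erase i) i

/-- Interim expected payoff, net of the payment, of buyer `i` with valuation `x` who reports `q`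
while the others report truthfully. (The `i`-th coordinate of `y` is overwritten.) -/
def DirectMechanism.interimPayoff (M : DirectMechanism N) (μ : Measure ℝ) (i : Fin N)
    (q x : ℝ) : ℝ :=
  ∫ y, (M.grossPayoff (Function.update y i x) (Function.update y i q) i
    - M.pay (Function.update y i q) i) ∂(jointLaw N μ)

/-- Expected payoff of buyer `i` with valuation `x` from the second auction alone, when the first
good is given to nobody. -/
def outsideOption (N : ℕ) (μ : Measure ℝ) (i : Fin N) (x : ℝ) : ℝ :=
  ∫ y, secondAuctionPayoff (Function.update y i x) (Finset.univ.erase i) i ∂(jointLaw N μ)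

/-- Expected revenue of the first seller under truthful reports. -/
def DirectMechanism.revenue (M : DirectMechanism N) (μ : Measure ℝ) : ℝ :=
  ∫ x, ∑ i, M.pay x i ∂(jointLaw N μ)

/-- The direct mechanisms among which the first seller chooses, the type space being `[lo, hi]`. -/
structure DirectMechanism.IsAdmissible (M : DirectMechanism N) (lo hi : ℝ) (μ : Measure ℝ) :
    Prop where
  measurable_alloc : ∀ i, Measurable fun x => M.alloc x i
  measurable_pay : ∀ i, Measurable fun x => M.pay x i
  /-- expected payments exist, ex ante and for each own report -/
  integrable_pay : ∀ i, Integrable (fun x => M.pay x i) (jointLaw N μ)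
  integrable_interim_pay : ∀ i, ∀ q ∈ Icc lo hi,
    Integrable (fun y => M.pay (Function.update y i q) i) (jointLaw N μ)
  /-- allocation probabilities are nonnegative and sum to at most one -/
  alloc_nonneg : ∀ x : Fin N → ℝ, (∀ i, x i ∈ Icc lo hi) → ∀ i, 0 ≤ M.alloc x i
  alloc_sum_le_one : ∀ x : Fin N → ℝ, (∀ i, x i ∈ Icc lo hi) → ∑ i, M.alloc x i ≤ 1
  /-- Bayesian incentive compatibility -/
  incentive_compatible : ∀ i, ∀ x ∈ Icc lo hi, ∀ q ∈ Icc lo hi,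
    M.interimPayoff μ i q x ≤ M.interimPayoff μ i x x
  /-- interim individual rationality -/
  individually_rational : ∀ i, ∀ x ∈ Icc lo hi, outsideOption N μ i x ≤ M.interimPayoff μ i x x

/-- A revenue-maximizing direct mechanism for the first seller. -/
def DirectMechanism.IsOptimal (M : DirectMechanism N) (lo hi : ℝ) (μ : Measure ℝ) : Prop :=
  M.IsAdmissible lo hi μ ∧
    ∀ M' : DirectMechanism N, M'.IsAdmissible lo hi μ → M'.revenue μ ≤ M.revenue μ

variable [NeZero N]

/-- The quantity `ψ(x₍₂₎) + x₍₂₎ - x₍₃₎`. -/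
def marginalRevenue (μ : Measure ℝ) (f : ℝ → ℝ) (x : Fin N → ℝ) : ℝ :=
  virtualValue μ f (orderStat x 1) + orderStat x 1 - orderStat x 2

/-- Probability that the buyer in position `k` gets the good: it goes to the second-highest buyer
(position `1`) if `ψ(x₍₂₎) + x₍₂₎ - x₍₃₎ ≥ 0`, and to nobody otherwise. -/
def rankAlloc (μ : Measure ℝ) (f : ℝ → ℝ) (x : Fin N → ℝ) (k : Fin N) : ℝ :=
  open Classical in if 0 ≤ marginalRevenue μ f x ∧ k = 1 then 1 else 0

/-- Payment of the buyer in position `k`. -/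
def rankPay (lo hi : ℝ) (μ : Measure ℝ) (f : ℝ → ℝ) (x : Fin N → ℝ) (k : Fin N) : ℝ :=
  open Classical in
  if 0 ≤ marginalRevenue μ f x then
    if virtualValue μ f (orderStat x 2) < 0 then
      if k = 0 then threshold lo hi μ f (orderStat x 2) - orderStat x 2
      else if k = 1 then threshold lo hi μ f (orderStat x 2)
      else 0
    else
      if k = 1 then orderStat x 2 else 0
  else 0

/-- The second-highest-bidder mechanism. Ties are broken uniformly at random: a ranking `σ` is drawn
uniformly from the rankings compatible with the reports, and buyer `i` takes position `σ⁻¹ i`. -/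
def secondBidderMechanism (N : ℕ) [NeZero N] (lo hi : ℝ) (μ : Measure ℝ) (f : ℝ → ℝ) :
    DirectMechanism N where
  alloc x i := (∑ σ ∈ rankings x, rankAlloc μ f x (σ⁻¹ i)) / (rankings x).card
  pay x i := (∑ σ ∈ rankings x, rankPay lo hi μ f x (σ⁻¹ i)) / (rankings x).card

end Buyers

end SeqAuction

end

/-!
By the envelope theorem, the expected revenue of an incentive-compatible mechanism is the expected
virtual surplus of the buyers in both auctions minus the rents of their lowest types. Compare it
with the mechanism that never allocates the good, whose revenue is zero: giving the good to buyer
`j` gains his virtual value and withdraws him from the second auction. The net effect on the virtual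
surplus is `ψ(x₍₂₎) + x₍₂₎ - x₍₃₎` if `j` is one of the two highest bidders, and
`ψ(x_j) ≤ ψ(x₍₂₎)` otherwise. Individual rationality makes the rents of the lowest types at least
their outside options, so the revenue is at most `E max (ψ(X₍₂₎) + X₍₂₎ - X₍₃₎) 0`.

In the second-highest-bidder mechanism, a buyer whose two highest rivals have valuations `r₁ ≥ r₂`
can get a good, from one seller or the other, at no better price than `min (a(r₂)) r₁`, and truthful
reporting gets him exactly this price whenever he gains from it. So truth-telling is optimal even ex
post and yields at least the outside option, with equality for the lowest type. Since the good is
allocated exactly when this raises the virtual surplus, the bound is attained.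
-/

noncomputable section

namespace SeqAuction

section ProductMeasure

variable {ι : Type*} [Fintype ι]

section Update

variable [DecidableEq ι] {X : ι → Type*} [∀ i, MeasurableSpace (X i)] (ν : ∀ i, Measure (X i))
  [∀ i, SigmaFinite (ν i)] (i : ι) [IsProbabilityMeasure (ν i)]

lemma measurePreserving_update :
    MeasurePreserving (fun p : X i × (∀ j, X j) => Function.update p.2 i p.1)
      ((ν i).prod (Measure.pi ν)) (Measure.pi ν) := by
  have hmeas : Measurable fun p : X i × (∀ j, X j) => Function.update p.2 i p.1 :=
    measurable_update'.comp measurable_swap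
  refine ⟨hmeas, (Measure.pi_eq fun s hs => ?_).symm⟩
  have hpre : (fun p : X i × (∀ j, X j) => Function.update p.2 i p.1) ⁻¹' univ.pi s
      = s i ×ˢ univ.pi (Function.update s i univ) := by
    ext ⟨a, y⟩
    simp only [mem_preimage, mem_univ_pi, mem_prod]
    refine ⟨fun H => ⟨by simpa using H i, fun j => ?_⟩, fun H j => ?_⟩
    · rcases eq_or_ne j i with rfl | hj
      · simp
      · simpa [hj] using H j
    · rcases eq_or_ne j i with rfl | hj
      · simpa using H.1
      · simpa [hj] using H.2 j
  rw [Measure.map_apply hmeas (MeasurableSet.univ_pi hs), hpre, Measure.prod_prod, Measure.pi_pi,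
    ← Finset.mul_prod_erase _ (fun j => ν j (s j)) (Finset.mem_univ i),
    ← Finset.mul_prod_erase _ (fun j => ν j (Function.update s i univ j)) (Finset.mem_univ i),
    Function.update_self, measure_univ, one_mul]
  congr 1
  exact Finset.prod_congr rfl fun j hj => by rw [Function.update_of_ne (Finset.ne_of_mem_erase hj)]

variable {ν}

lemma integral_pi_eq_integral_update {E : Type*} [NormedAddCommGroup E] [NormedSpace ℝ E]
    {F : (∀ j, X j) → E} (hF : Integrable F (Measure.pi ν)) :
    ∫ x, F x ∂(Measure.pi ν) = ∫ s, ∫ y, F (Function.update y i s) ∂(Measure.pi ν) ∂(ν i) := by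
  have hmp := measurePreserving_update ν i
  calc ∫ x, F x ∂(Measure.pi ν)
      = ∫ p, F (Function.update p.2 i p.1) ∂((ν i).prod (Measure.pi ν)) := by
        conv_lhs => rw [← hmp.map_eq]
        exact integral_map hmp.measurable.aemeasurable (by rw [hmp.map_eq]; exact hF.1)
    _ = ∫ s, ∫ y, F (Function.update y i s) ∂(Measure.pi ν) ∂(ν i) :=
        integral_prod _ (hmp.integrable_comp_of_integrable hF)

end Update

lemma ae_pi_injective {X : Type*} [MeasurableSpace X] [MeasurableEq X] (ν : ι → Measure X)
    [∀ i, IsProbabilityMeasure (ν i)] [∀ i, NullSingletonClass (ν i)] :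
    ∀ᵐ y ∂(Measure.pi ν), Function.Injective y := by
  classical
  have hne : ∀ i j, i ≠ j → ∀ᵐ y ∂(Measure.pi ν), y i ≠ y j := by
    intro i j hij
    have hmp := measurePreserving_update ν i
    have hms : MeasurableSet {y : ι → X | y i ≠ y j} :=
      (measurableSet_eq_fun (measurable_pi_apply i) (measurable_pi_apply j)).compl
    rw [← hmp.map_eq, ae_map_iff hmp.measurable.aemeasurable hms]
    refine (Measure.ae_prod_iff_ae_ae (hmp.measurable hms)).2 (.of_forall fun s => ?_)
    filter_upwards [Measure.ae_eval_ne (μ := ν) j s] with y hy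
    simpa [hij.symm] using hy.symm
  have hall : ∀ᵐ y ∂(Measure.pi ν), ∀ i j, i ≠ j → y i ≠ y j := by
    simpa only [ae_all_iff] using hne
  filter_upwards [hall] with y hy i j
  exact not_imp_not.1 (hy i j)

end ProductMeasure

section Envelope

lemma setIntegral_indicator_Iio_deriv {U : ℝ → ℝ} {a b x : ℝ}
    (hU : AbsolutelyContinuousOnInterval U a b) (hx : x ∈ Icc a b) :
    ∫ t in Ioc a b, (Iio x).indicator (deriv U) t = U x - U a := by
  have hset : Ioc a b ∩ Iio x = Ioo a x := by
    ext t
    exact ⟨fun h => ⟨h.1.1, h.2⟩, fun h => ⟨⟨h.1, h.2.le.trans hx.2⟩, h.2⟩⟩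
  have hUx : AbsolutelyContinuousOnInterval U a x :=
    hU.mono (by rw [uIcc_of_le hx.1, uIcc_of_le (hx.1.trans hx.2)]; exact Icc_subset_Icc_right hx.2)
  rw [← hUx.integral_deriv_eq_sub, intervalIntegral.integral_of_le hx.1,
    setIntegral_indicator measurableSet_Iio, hset, integral_Ioc_eq_integral_Ioo]

lemma integral_eq_add_integral_deriv_mul_one_sub_cdf {μ : Measure ℝ} [IsProbabilityMeasure μ]
    {a b : ℝ} (hsupp : ∀ᵐ x ∂μ, x ∈ Icc a b) {U : ℝ → ℝ}
    (hU : AbsolutelyContinuousOnInterval U a b) :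
    ∫ x, U x ∂μ = U a + ∫ t in a..b, deriv U t * (1 - cdf μ t) := by
  obtain ⟨c, hc⟩ := hsupp.exists
  have hab : a ≤ b := hc.1.trans hc.2
  let k (x t : ℝ) : ℝ := (Iio x).indicator (deriv U) t
  have hk : Integrable (Function.uncurry k) (μ.prod (volume.restrict (Ioc a b))) :=
    ((intervalIntegrable_iff_integrableOn_Ioc_of_le hab).1
      hU.intervalIntegrable_deriv).integrable.comp_snd μ |>.indicator
        (measurableSet_lt measurable_snd measurable_fst)
  have hk_int : Integrable (fun x => ∫ t in Ioc a b, k x t) μ := hk.integral_prod_left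
  have hsurv : ∀ t, ∫ x, k x t ∂μ = deriv U t * (1 - cdf μ t) := by
    intro t
    calc ∫ x, k x t ∂μ = ∫ x, (Ioi t).indicator (fun _ => deriv U t) x ∂μ := rfl
      _ = deriv U t * (1 - cdf μ t) := by
        rw [integral_indicator_const _ measurableSet_Ioi, smul_eq_mul, mul_comm, cdf_eq_real,
          ← compl_Iic, probReal_compl_eq_one_sub measurableSet_Iic]
  calc ∫ x, U x ∂μ = ∫ x, (U a + ∫ t in Ioc a b, k x t) ∂μ :=
        integral_congr_ae <| hsupp.mono fun x hx => by
          simp only [k, setIntegral_indicator_Iio_deriv hU hx, add_sub_cancel]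
    _ = U a + ∫ x, (∫ t in Ioc a b, k x t) ∂μ := by
        rw [integral_add (integrable_const _) hk_int, integral_const, probReal_univ, one_smul]
    _ = U a + ∫ t in a..b, deriv U t * (1 - cdf μ t) := by
        rw [integral_integral_swap hk, intervalIntegral.integral_of_le hab]
        simp only [hsurv]

lemma lipschitzOnWith_of_sub_le_sub {X : Type*} [PseudoMetricSpace X] {K : NNReal} {s : Set X}
    {U : X → ℝ} {φ : X → X → ℝ} (hφ : ∀ q ∈ s, LipschitzOnWith K (φ q) s)
    (hle : ∀ q ∈ s, ∀ x ∈ s, φ q x - φ q q ≤ U x - U q) : LipschitzOnWith K U s := by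
  refine LipschitzOnWith.of_le_add_mul K fun x hx y hy => ?_
  have hlip := (abs_le.1 ((hφ x hx).dist_le_mul x hx y hy)).2
  linarith [hle x hx y hy]

lemma deriv_eq_of_sub_le_sub {U φ : ℝ → ℝ} {s c : ℝ} (hU : DifferentiableAt ℝ U s)
    (hφ : HasDerivAt φ c s) (hle : ∀ᶠ x in nhds s, φ x - φ s ≤ U x - U s) : deriv U s = c := by
  have hmin : IsLocalMin (U - φ) s := by
    filter_upwards [hle] with x hx
    simp only [Pi.sub_apply]
    linarith
  linarith [hmin.hasDerivAt_eq_zero (hU.hasDerivAt.sub hφ)]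

lemma integral_eq_add_integral_mul_one_sub_cdf_of_envelope {μ : Measure ℝ} [IsProbabilityMeasure μ]
    {a b : ℝ} (hsupp : ∀ᵐ x ∂μ, x ∈ Icc a b) {K : NNReal} {U c : ℝ → ℝ} {φ : ℝ → ℝ → ℝ}
    (hφ : ∀ q ∈ Icc a b, LipschitzOnWith K (φ q) (Icc a b))
    (hderiv : ∀ s ∈ Ioo a b, HasDerivAt (φ s) (c s) s)
    (hle : ∀ q ∈ Icc a b, ∀ x ∈ Icc a b, φ q x - φ q q ≤ U x - U q) :
    ∫ x, U x ∂μ = U a + ∫ t in a..b, c t * (1 - cdf μ t) := by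
  obtain ⟨x₀, hx₀⟩ := hsupp.exists
  have hab : a ≤ b := hx₀.1.trans hx₀.2
  have hac : AbsolutelyContinuousOnInterval U a b := by
    refine LipschitzOnWith.absolutelyContinuousOnInterval (K := K) ?_
    rw [uIcc_of_le hab]
    exact lipschitzOnWith_of_sub_le_sub hφ hle
  rw [integral_eq_add_integral_deriv_mul_one_sub_cdf hsupp hac]
  congr 1
  refine intervalIntegral.integral_congr_ae ?_
  filter_upwards [hac.ae_differentiableAt, Measure.ae_ne volume b] with s hs hsb hsI
  have hsab : s ∈ Ioo a b := by
    rw [uIoc_of_le hab] at hsI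
    exact ⟨hsI.1, hsI.2.lt_of_ne hsb⟩
  rw [deriv_eq_of_sub_le_sub (hs (uIoc_subset_uIcc hsI)) (hderiv s hsab)]
  filter_upwards [Ioo_mem_nhds hsab.1 hsab.2] with x hx
  exact hle s (Ioo_subset_Icc_self hsab) x (Ioo_subset_Icc_self hx)

end Envelope

/-- The inverse hazard rate `(1 - F) / f`, the information rent entering the virtual value. -/
def invHazard (μ : Measure ℝ) (f : ℝ → ℝ) (x : ℝ) : ℝ := (1 - cdf μ x) / f x

lemma virtualValue_eq_sub_invHazard (μ : Measure ℝ) (f : ℝ → ℝ) (x : ℝ) :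
    virtualValue μ f x = x - invHazard μ f x := rfl

/-- `f` is a density of `μ` that is continuous on its support `[lo, hi]` and positive there, except
possibly at the top. -/
structure IsPriorDensity (lo hi : ℝ) (μ : Measure ℝ) (f : ℝ → ℝ) : Prop where
  lo_lt_hi : lo < hi
  eq_withDensity : μ = volume.withDensity fun x => ENNReal.ofReal (f x)
  eq_zero_of_notMem : ∀ x, x ∉ Icc lo hi → f x = 0
  continuousOn : ContinuousOn f (Icc lo hi)
  pos : ∀ x ∈ Ico lo hi, 0 < f x

namespace IsPriorDensity

variable {lo hi : ℝ} {μ : Measure ℝ} {f : ℝ → ℝ}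

lemma measurable (h : IsPriorDensity lo hi μ f) : Measurable f := by
  classical
  have hf : f = (Icc lo hi).piecewise f 0 := by
    ext x
    by_cases hx : x ∈ Icc lo hi
    · simp [hx]
    · simp [hx, h.eq_zero_of_notMem x hx]
  rw [hf]
  exact h.continuousOn.measurable_piecewise continuousOn_const measurableSet_Icc

lemma nonneg (h : IsPriorDensity lo hi μ f) (x : ℝ) : 0 ≤ f x := by
  by_cases hx : x ∈ Icc lo hi
  · have hcl : x ∈ closure (Ico lo hi) := by rwa [closure_Ico h.lo_lt_hi.ne]
    exact ContinuousWithinAt.closure_le hcl continuousWithinAt_const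
      ((h.continuousOn x hx).mono Ico_subset_Icc_self) fun y hy => (h.pos y hy).le
  · rw [h.eq_zero_of_notMem x hx]

lemma nullSingletonClass (h : IsPriorDensity lo hi μ f) : NullSingletonClass μ := by
  rw [h.eq_withDensity]
  infer_instance

lemma ae_mem_Icc (h : IsPriorDensity lo hi μ f) : ∀ᵐ x ∂μ, x ∈ Icc lo hi := by
  rw [h.eq_withDensity, ae_withDensity_iff h.measurable.ennreal_ofReal]
  refine .of_forall fun x hx => ?_
  by_contra hn
  simp [h.eq_zero_of_notMem x hn] at hx

lemma integral_eq (h : IsPriorDensity lo hi μ f) (g : ℝ → ℝ) :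
    ∫ x, g x ∂μ = ∫ x in lo..hi, f x * g x := by
  rw [h.eq_withDensity, integral_withDensity_eq_integral_toReal_smul
    h.measurable.ennreal_ofReal (by simp), intervalIntegral.integral_of_le h.lo_lt_hi.le,
    ← integral_Icc_eq_integral_Ioc, setIntegral_eq_integral_of_forall_compl_eq_zero]
  · simp only [ENNReal.toReal_ofReal (h.nonneg _), smul_eq_mul]
  · intro x hx
    rw [h.eq_zero_of_notMem x hx, zero_mul]

lemma invHazard_nonneg (h : IsPriorDensity lo hi μ f) (x : ℝ) : 0 ≤ invHazard μ f x :=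
  div_nonneg (sub_nonneg.2 (cdf_le_one μ x)) (h.nonneg x)

lemma measurable_invHazard (h : IsPriorDensity lo hi μ f) : Measurable (invHazard μ f) :=
  (measurable_const.sub (monotone_cdf μ).measurable).div h.measurable

lemma measurable_virtualValue (h : IsPriorDensity lo hi μ f) : Measurable (virtualValue μ f) :=
  measurable_id.sub h.measurable_invHazard

section InvHazard

variable [IsProbabilityMeasure μ]

lemma cdf_lo (h : IsPriorDensity lo hi μ f) : cdf μ lo = 0 := by
  have := h.nullSingletonClass
  have hlt : ∀ᵐ x ∂μ, x ∉ Iic lo := by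
    filter_upwards [h.ae_mem_Icc, Measure.ae_ne μ lo] with x hx hne
    exact not_le.2 (hx.1.lt_of_ne' hne)
  rw [cdf_eq_real, measureReal_def, measure_eq_zero_iff_ae_notMem.2 hlt, ENNReal.toReal_zero]

lemma cdf_hi (h : IsPriorDensity lo hi μ f) : cdf μ hi = 1 := by
  have hle : Iic hi ∈ ae μ := h.ae_mem_Icc.mono fun _ hx => hx.2
  rw [cdf_eq_real, measureReal_def, (mem_ae_iff_prob_eq_one measurableSet_Iic).1 hle,
    ENNReal.toReal_one]

lemma virtualValue_hi (h : IsPriorDensity lo hi μ f) : virtualValue μ f hi = hi := by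
  rw [virtualValue, h.cdf_hi, sub_self, zero_div, sub_zero]

lemma density_mul_invHazard (h : IsPriorDensity lo hi μ f) {x : ℝ} (hx : x ∈ Icc lo hi) :
    f x * invHazard μ f x = 1 - cdf μ x := by
  rcases hx.2.eq_or_lt with rfl | hlt
  · simp [invHazard, h.cdf_hi]
  · rw [invHazard, mul_div_cancel₀ _ (h.pos x ⟨hx.1, hlt⟩).ne']

lemma integrable_invHazard (h : IsPriorDensity lo hi μ f) : Integrable (invHazard μ f) μ := by
  have hsurv : Integrable ((Icc lo hi).indicator fun x => 1 - cdf μ x) :=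
    (integrable_indicator_iff measurableSet_Icc).2 <|
      (((monotone_cdf μ).neg.const_add 1).antitoneOn _).integrableOn_isCompact isCompact_Icc
  rw [h.eq_withDensity, integrable_withDensity_iff h.measurable.ennreal_ofReal (by simp),
    ← h.eq_withDensity]
  refine hsurv.congr (.of_forall fun x => ?_)
  simp only [ENNReal.toReal_ofReal (h.nonneg x)]
  by_cases hx : x ∈ Icc lo hi
  · rw [indicator_of_mem hx, ← h.density_mul_invHazard hx, mul_comm]
  · rw [indicator_of_notMem hx, h.eq_zero_of_notMem x hx, mul_zero]

lemma integral_mul_invHazard (h : IsPriorDensity lo hi μ f) (g : ℝ → ℝ) :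
    ∫ x, g x * invHazard μ f x ∂μ = ∫ x in lo..hi, g x * (1 - cdf μ x) := by
  rw [h.integral_eq]
  refine intervalIntegral.integral_congr fun x hx => ?_
  rw [uIcc_of_le h.lo_lt_hi.le] at hx
  simp only [← h.density_mul_invHazard hx]
  ring

end InvHazard

section Threshold

lemma bddBelow_thresholdSet (lo hi : ℝ) (μ : Measure ℝ) (f : ℝ → ℝ) (x : ℝ) :
    BddBelow (thresholdSet lo hi μ f x) := ⟨lo, fun _ ha => ha.1.1⟩

lemma continuousWithinAt_virtualValue (h : IsPriorDensity lo hi μ f) {c : ℝ} (hc : c ∈ Ico lo hi) :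
    ContinuousWithinAt (virtualValue μ f) (Icc c hi) c :=
  continuousWithinAt_id.sub <| ContinuousWithinAt.div
    (continuousWithinAt_const.sub (((cdf μ).right_continuous c).mono Icc_subset_Ici_self))
    ((h.continuousOn c (Ico_subset_Icc_self hc)).mono (Icc_subset_Icc_left hc.1)) (h.pos c hc).ne'

variable [IsProbabilityMeasure μ]

lemma hi_mem_thresholdSet (h : IsPriorDensity lo hi μ f) (hlo : 0 ≤ lo) {x : ℝ} (hx : x ≤ hi) :
    hi ∈ thresholdSet lo hi μ f x := by
  refine ⟨right_mem_Icc.2 h.lo_lt_hi.le, hx, ?_⟩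
  rw [h.virtualValue_hi]
  linarith [h.lo_lt_hi]

lemma isLeast_threshold (h : IsPriorDensity lo hi μ f) (hlo : 0 ≤ lo) {x : ℝ} (hx : x ≤ hi) :
    IsLeast (thresholdSet lo hi μ f x) (threshold lo hi μ f x) := by
  have hhi := h.hi_mem_thresholdSet hlo hx
  have hne : (thresholdSet lo hi μ f x).Nonempty := ⟨hi, hhi⟩
  have hbdd := bddBelow_thresholdSet lo hi μ f x
  set c := threshold lo hi μ f x
  have hlb : ∀ a ∈ thresholdSet lo hi μ f x, c ≤ a := fun a ha => csInf_le hbdd ha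
  have hlc : lo ≤ c := le_csInf hne fun a ha => ha.1.1
  have hxc : x ≤ c := le_csInf hne fun a ha => ha.2.1
  refine ⟨?_, hlb⟩
  -- `f` may vanish at `hi`, so `ψ` need not be continuous there.
  rcases (hlb hi hhi).eq_or_lt with heq | hlt
  · rwa [heq]
  have hcont : ContinuousWithinAt (fun a => a + virtualValue μ f a) (thresholdSet lo hi μ f x) c :=
    continuousWithinAt_id.add ((h.continuousWithinAt_virtualValue ⟨hlc, hlt⟩).mono
      fun a ha => ⟨hlb a ha, ha.1.2⟩)
  exact ⟨⟨hlc, hlt.le⟩, hxc, ContinuousWithinAt.closure_le (csInf_mem_closure hne hbdd)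
    continuousWithinAt_const hcont fun a ha => ha.2.2⟩

lemma le_threshold (h : IsPriorDensity lo hi μ f) (hlo : 0 ≤ lo) {x : ℝ} (hx : x ≤ hi) :
    x ≤ threshold lo hi μ f x :=
  (h.isLeast_threshold hlo hx).1.2.1

lemma threshold_le_iff (h : IsPriorDensity lo hi μ f) (hlo : 0 ≤ lo)
    (hψ : MonotoneOn (virtualValue μ f) (Icc lo hi)) {x a : ℝ} (ha : a ∈ Icc lo hi) (hxa : x ≤ a) :
    threshold lo hi μ f x ≤ a ↔ 0 ≤ virtualValue μ f a + a - x := by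
  obtain ⟨⟨hmem, -, hge⟩, hlb⟩ := h.isLeast_threshold hlo (hxa.trans ha.2)
  exact ⟨fun hle => by linarith [hψ hmem ha hle], fun h0 => hlb ⟨ha, hxa, by linarith⟩⟩

lemma threshold_eq_self (h : IsPriorDensity lo hi μ f) (hlo : 0 ≤ lo) {x : ℝ} (hx : x ∈ Icc lo hi)
    (h0 : 0 ≤ virtualValue μ f x) : threshold lo hi μ f x = x :=
  ((h.isLeast_threshold hlo hx.2).2 ⟨hx, le_rfl, by linarith⟩).antisymm (h.le_threshold hlo hx.2)

lemma lt_threshold (h : IsPriorDensity lo hi μ f) (hlo : 0 ≤ lo) {x : ℝ} (hx : x ≤ hi)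
    (h0 : virtualValue μ f x < 0) : x < threshold lo hi μ f x := by
  obtain ⟨-, hle, hge⟩ := (h.isLeast_threshold hlo hx).1
  refine hle.lt_of_ne fun heq => ?_
  rw [← heq] at hge
  linarith

lemma pos_of_virtualValue_nonneg (h : IsPriorDensity lo hi μ f) (hlo : 0 ≤ lo) {x : ℝ}
    (hx : x ∈ Icc lo hi) (h0 : 0 ≤ virtualValue μ f x) : 0 < x := by
  rcases hx.1.eq_or_lt with rfl | hlt
  · have hlt : 0 < invHazard μ f lo := by
      rw [invHazard, h.cdf_lo, sub_zero]
      exact one_div_pos.2 (h.pos lo (left_mem_Ico.2 h.lo_lt_hi))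
    rw [virtualValue_eq_sub_invHazard] at h0
    linarith
  · exact hlo.trans_lt hlt

lemma measurable_threshold (h : IsPriorDensity lo hi μ f) (hlo : 0 ≤ lo) :
    Measurable (threshold lo hi μ f) := by
  have hmono : Monotone fun x => threshold lo hi μ f (min x hi) := fun x y hxy =>
    csInf_le_csInf (bddBelow_thresholdSet lo hi μ f _)
      ⟨hi, h.hi_mem_thresholdSet hlo (min_le_right y hi)⟩
      fun _ ha => ⟨ha.1, (min_le_min_right hi hxy).trans ha.2.1,
        (min_le_min_right hi hxy).trans ha.2.2⟩
  have heq : threshold lo hi μ f =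
      fun x => if x ≤ hi then threshold lo hi μ f (min x hi) else 0 := by
    ext x
    split_ifs with hx
    · rw [min_eq_left hx]
    · have hempty : thresholdSet lo hi μ f x = ∅ :=
        eq_empty_of_forall_notMem fun a ha => hx (ha.2.1.trans ha.1.2)
      rw [threshold, hempty, Real.sInf_empty]
  rw [heq]
  exact Measurable.ite measurableSet_Iic hmono.measurable measurable_const

end Threshold

end IsPriorDensity

section FoldMax

variable {ι α : Type*} [LinearOrder α] {b : α} {v : ι → α} {S : Finset ι}

lemma le_fold_max_self (b : α) (v : ι → α) (S : Finset ι) : b ≤ S.fold max b v :=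
  (Finset.le_fold_max _).2 (.inl le_rfl)

lemma fold_max_eq_of_forall_le {m : ι} (hm : m ∈ S) (hb : b ≤ v m) (hle : ∀ k ∈ S, v k ≤ v m) :
    S.fold max b v = v m :=
  le_antisymm ((Finset.fold_max_le _).2 ⟨hb, hle⟩)
    ((Finset.le_fold_max _).2 (.inr ⟨m, hm, le_rfl⟩))

lemma fold_max_ne {s : α} (hb : b ≠ s) (hv : ∀ k ∈ S, v k ≠ s) : S.fold max b v ≠ s := by
  intro heq
  have hle := (Finset.fold_max_le _).1 heq.le
  rcases (Finset.le_fold_max _).1 heq.ge with h | ⟨k, hk, h⟩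
  · exact hb (hle.1.antisymm h)
  · exact hv k hk ((hle.2 k hk).antisymm h)

lemma fold_max_update [DecidableEq ι] {i : ι} (hi : i ∉ S) (x : α) :
    S.fold max b (Function.update v i x) = S.fold max b v :=
  Finset.fold_congr fun _ hk => Function.update_of_ne (ne_of_mem_of_not_mem hk hi) _ _

lemma measurable_fold_max [TopologicalSpace α] [MeasurableSpace α] [OpensMeasurableSpace α]
    [OrderClosedTopology α] [SecondCountableTopology α] (b : α) (S : Finset ι) :
    Measurable fun v : ι → α => S.fold max b v := by
  classical
  induction S using Finset.induction_on with
  | empty => simp only [Finset.fold_empty, measurable_const]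
  | insert a S ha ih =>
    simp only [Finset.fold_insert ha]
    exact (measurable_pi_apply a).max ih

end FoldMax

section Update

variable {ι : Type*} [DecidableEq ι] {α : Type*} {y : ι → α} {q : α}

lemma update_injective (hy : Function.Injective y) (i : ι) (hq : ∀ j, y j ≠ q) :
    Function.Injective (Function.update y i q) := by
  intro a b hab
  simp only [Function.update_apply] at hab
  split_ifs at hab with ha hb hb
  · rw [ha, hb]
  · exact absurd hab.symm (hq b)
  · exact absurd hab (hq a)
  · exact hy hab

lemma update_mem {s : Set α} (hy : ∀ j, y j ∈ s) (i : ι) (hq : q ∈ s) (j : ι) :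
    Function.update y i q j ∈ s := by
  rw [Function.update_apply]
  split_ifs
  exacts [hq, hy j]

end Update

variable {N : ℕ}

section SecondAuction

variable {v y : Fin N → ℝ} {S : Finset (Fin N)} {i : Fin N}

/-- The derivative of `secondAuctionPayoff` in the own valuation, off ties. -/
def secondAuctionSlope (v : Fin N → ℝ) (S : Finset (Fin N)) (i : Fin N) : ℝ :=
  if S.fold max 0 v < v i then 1 else 0

lemma measurable_secondAuctionPayoff (S : Finset (Fin N)) (i : Fin N) :
    Measurable fun v => secondAuctionPayoff v S i :=
  ((measurable_pi_apply i).sub (measurable_fold_max 0 S)).max measurable_const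

lemma measurable_secondAuctionSlope (S : Finset (Fin N)) (i : Fin N) :
    Measurable fun v => secondAuctionSlope v S i :=
  Measurable.ite (measurableSet_lt (measurable_fold_max 0 S) (measurable_pi_apply i))
    measurable_const measurable_const

lemma secondAuctionPayoff_mem_Icc (hv : 0 ≤ v i) : secondAuctionPayoff v S i ∈ Icc 0 (v i) :=
  ⟨le_max_right _ _, max_le (sub_le_self _ (le_fold_max_self _ _ _)) hv⟩

lemma secondAuctionSlope_mem_Icc : secondAuctionSlope v S i ∈ Icc 0 1 := by
  rw [secondAuctionSlope]
  split_ifs <;> simp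

lemma abs_secondAuctionPayoff_update_sub_le (hi : i ∉ S) (x x' : ℝ) :
    |secondAuctionPayoff (Function.update y i x) S i
      - secondAuctionPayoff (Function.update y i x') S i| ≤ |x - x'| := by
  simp only [secondAuctionPayoff, fold_max_update hi, Function.update_self]
  refine (abs_max_sub_max_le_abs _ _ _).trans_eq ?_
  rw [sub_sub_sub_cancel_right]

lemma hasDerivAt_secondAuctionPayoff (hi : i ∉ S) {s : ℝ} (hs : s ≠ 0) (hy : ∀ k ∈ S, y k ≠ s) :
    HasDerivAt (fun x => secondAuctionPayoff (Function.update y i x) S i)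
      (secondAuctionSlope (Function.update y i s) S i) s := by
  simp only [secondAuctionPayoff, secondAuctionSlope, fold_max_update hi, Function.update_self]
  rcases lt_or_gt_of_ne (fold_max_ne hs.symm hy) with hlt | hgt
  · rw [if_pos hlt]
    refine ((hasDerivAt_id s).sub_const (S.fold max 0 y)).congr_of_eventuallyEq ?_
    filter_upwards [lt_mem_nhds hlt] with x hx
    exact max_eq_left (sub_nonneg.2 hx.le)
  · rw [if_neg hgt.le.not_gt]
    refine (hasDerivAt_const s (0 : ℝ)).congr_of_eventuallyEq ?_
    filter_upwards [gt_mem_nhds hgt] with x hx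
    exact max_eq_right (sub_nonpos.2 hx.le)

end SecondAuction

namespace DirectMechanism

section Average

variable {M : DirectMechanism N} {v b y : Fin N → ℝ}

/-- The allocation probabilities at the reports `b` form a subprobability on the buyers. -/
def FeasibleAt (M : DirectMechanism N) (b : Fin N → ℝ) : Prop :=
  (∀ i, 0 ≤ M.alloc b i) ∧ ∑ i, M.alloc b i ≤ 1

/-- The average, over the allocation of the good at the reports `b`, of `own` if `i` gets it and of
`p S` if `i` meets the set `S` of rivals in the second auction. -/
def average (M : DirectMechanism N) (b : Fin N → ℝ) (i : Fin N) (own : ℝ)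
    (p : Finset (Fin N) → ℝ) : ℝ :=
  M.alloc b i * own
    + ∑ j ∈ Finset.univ.erase i, M.alloc b j * p ((Finset.univ.erase i).erase j)
    + (1 - ∑ j, M.alloc b j) * p (Finset.univ.erase i)

/-- The derivative of the gross payoff in the own valuation, off ties. -/
def grossSlope (M : DirectMechanism N) (v b : Fin N → ℝ) (i : Fin N) : ℝ :=
  M.average b i 1 fun S => secondAuctionSlope v S i

lemma grossPayoff_eq_average (M : DirectMechanism N) (v b : Fin N → ℝ) (i : Fin N) :
    M.grossPayoff v b i = M.average b i (v i) fun S => secondAuctionPayoff v S i := rfl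

lemma average_const (M : DirectMechanism N) (b : Fin N → ℝ) (i : Fin N) (c : ℝ) :
    M.average b i c (fun _ => c) = c := by
  rw [average, ← Finset.sum_mul, ← Finset.add_sum_erase _ _ (Finset.mem_univ i)]
  ring

lemma average_sub (M : DirectMechanism N) (b : Fin N → ℝ) (i : Fin N) (a a' : ℝ)
    (p p' : Finset (Fin N) → ℝ) :
    M.average b i (a - a') (fun S => p S - p' S) = M.average b i a p - M.average b i a' p' := by
  simp only [average, mul_sub, Finset.sum_sub_distrib]
  ring

lemma average_const_mul (M : DirectMechanism N) (b : Fin N → ℝ) (i : Fin N) (c a : ℝ)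
    (p : Finset (Fin N) → ℝ) :
    M.average b i (c * a) (fun S => c * p S) = c * M.average b i a p := by
  simp only [average, mul_left_comm _ c, ← Finset.mul_sum]
  ring

lemma average_mono (hb : M.FeasibleAt b) (i : Fin N) {a a' : ℝ} {p p' : Finset (Fin N) → ℝ}
    (ha : a ≤ a') (hp : ∀ S, i ∉ S → p S ≤ p' S) : M.average b i a p ≤ M.average b i a' p' := by
  refine add_le_add (add_le_add (mul_le_mul_of_nonneg_left ha (hb.1 i)) ?_) ?_
  · exact Finset.sum_le_sum fun j _ => mul_le_mul_of_nonneg_left (hp _ (by simp)) (hb.1 j)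
  · exact mul_le_mul_of_nonneg_left (hp _ (by simp)) (sub_nonneg.2 hb.2)

lemma average_mem_Icc (hb : M.FeasibleAt b) {i : Fin N} {a c d : ℝ} {p : Finset (Fin N) → ℝ}
    (ha : a ∈ Icc c d) (hp : ∀ S, i ∉ S → p S ∈ Icc c d) : M.average b i a p ∈ Icc c d := by
  constructor
  · rw [← M.average_const b i c]
    exact average_mono hb i ha.1 fun S hS => (hp S hS).1
  · rw [← M.average_const b i d]
    exact average_mono hb i ha.2 fun S hS => (hp S hS).2

lemma grossPayoff_mem_Icc (hb : M.FeasibleAt b) {i : Fin N} (hv : 0 ≤ v i) :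
    M.grossPayoff v b i ∈ Icc 0 (v i) := by
  rw [grossPayoff_eq_average]
  exact average_mem_Icc hb (right_mem_Icc.2 hv) fun _ _ => secondAuctionPayoff_mem_Icc hv

lemma grossSlope_mem_Icc (hb : M.FeasibleAt b) (v : Fin N → ℝ) (i : Fin N) :
    M.grossSlope v b i ∈ Icc 0 1 := by
  rw [grossSlope]
  exact average_mem_Icc hb (right_mem_Icc.2 zero_le_one) fun _ _ => secondAuctionSlope_mem_Icc

lemma abs_grossPayoff_update_sub_le (hb : M.FeasibleAt b) (y : Fin N → ℝ) (i : Fin N) (x x' : ℝ) :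
    |M.grossPayoff (Function.update y i x) b i - M.grossPayoff (Function.update y i x') b i|
      ≤ |x - x'| := by
  simp only [grossPayoff_eq_average, ← average_sub, Function.update_self]
  exact abs_le.2 (average_mem_Icc hb (abs_le.1 le_rfl) fun S hS =>
    abs_le.1 (abs_secondAuctionPayoff_update_sub_le hS x x'))

lemma hasDerivAt_grossPayoff (M : DirectMechanism N) (b : Fin N → ℝ) (i : Fin N) {s : ℝ}
    (hs : s ≠ 0) (hy : ∀ k, y k ≠ s) :
    HasDerivAt (fun x => M.grossPayoff (Function.update y i x) b i)
      (M.grossSlope (Function.update y i s) b i) s := by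
  simp only [grossPayoff_eq_average, grossSlope, average, Function.update_self]
  have hauction : ∀ S, i ∉ S → HasDerivAt (fun x => secondAuctionPayoff (Function.update y i x) S i)
      (secondAuctionSlope (Function.update y i s) S i) s :=
    fun S hS => hasDerivAt_secondAuctionPayoff hS hs fun k _ => hy k
  exact (((hasDerivAt_id s).const_mul _).add <| HasDerivAt.fun_sum fun j _ =>
    (hauction _ (by simp)).const_mul _).add ((hauction _ (by simp)).const_mul _)

lemma measurable_average {α : Type*} [MeasurableSpace α]
    (hM : ∀ i, Measurable fun x => M.alloc x i) {b : α → Fin N → ℝ} (hb : Measurable b) (i : Fin N)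
    {a : α → ℝ} (ha : Measurable a) {p : α → Finset (Fin N) → ℝ}
    (hp : ∀ S, Measurable fun x => p x S) : Measurable fun x => M.average (b x) i (a x) (p x) := by
  have halloc : ∀ j, Measurable fun x => M.alloc (b x) j := fun j => (hM j).comp hb
  exact (((halloc i).mul ha).add <| Finset.measurable_fun_sum _ fun j _ =>
    (halloc j).mul (hp _)).add <|
      (measurable_const.sub (Finset.measurable_fun_sum _ fun j _ => halloc j)).mul (hp _)

lemma measurable_grossPayoff {α : Type*} [MeasurableSpace α]
    (hM : ∀ i, Measurable fun x => M.alloc x i) {v b : α → Fin N → ℝ} (hv : Measurable v)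
    (hb : Measurable b) (i : Fin N) : Measurable fun x => M.grossPayoff (v x) (b x) i :=
  measurable_average hM hb i ((measurable_pi_apply i).comp hv)
    fun S => (measurable_secondAuctionPayoff S i).comp hv

lemma measurable_grossSlope {α : Type*} [MeasurableSpace α]
    (hM : ∀ i, Measurable fun x => M.alloc x i) {v b : α → Fin N → ℝ} (hv : Measurable v)
    (hb : Measurable b) (i : Fin N) : Measurable fun x => M.grossSlope (v x) (b x) i :=
  measurable_average hM hb i measurable_const
    fun S => (measurable_secondAuctionSlope S i).comp hv

end Average

end DirectMechanism

section JointLaw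

variable {μ : Measure ℝ} [IsProbabilityMeasure μ] {lo hi : ℝ}

instance : IsProbabilityMeasure (jointLaw N μ) := by
  unfold jointLaw
  infer_instance

lemma measurePreserving_eval_jointLaw (i : Fin N) :
    MeasurePreserving (fun y : Fin N → ℝ => y i) (jointLaw N μ) μ :=
  measurePreserving_eval (fun _ => μ) i

lemma integral_jointLaw_eq_integral_update (i : Fin N) {F : (Fin N → ℝ) → ℝ}
    (hF : Integrable F (jointLaw N μ)) :
    ∫ x, F x ∂(jointLaw N μ) = ∫ s, ∫ y, F (Function.update y i s) ∂(jointLaw N μ) ∂μ :=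
  integral_pi_eq_integral_update i hF

lemma ae_forall_mem_Icc (hsupp : ∀ᵐ x ∂μ, x ∈ Icc lo hi) :
    ∀ᵐ y ∂(jointLaw N μ), ∀ i, y i ∈ Icc lo hi :=
  ae_all_iff.2 fun i => (measurePreserving_eval_jointLaw i).quasiMeasurePreserving.ae hsupp

variable [NullSingletonClass μ]

lemma ae_forall_ne (q : ℝ) : ∀ᵐ y ∂(jointLaw N μ), ∀ i, y i ≠ q :=
  ae_all_iff.2 fun i => Measure.ae_eval_ne (μ := fun _ : Fin N => μ) i q

lemma ae_injective : ∀ᵐ y ∂(jointLaw N μ), Function.Injective y :=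
  ae_pi_injective fun _ => μ

end JointLaw

namespace DirectMechanism

variable {M : DirectMechanism N} {μ : Measure ℝ} {f : ℝ → ℝ} {lo hi : ℝ} {i : Fin N}

/-- Interim expected payoff, gross of payments, of buyer `i` with valuation `x` who reports `q`. -/
def interimGross (M : DirectMechanism N) (μ : Measure ℝ) (i : Fin N) (q x : ℝ) : ℝ :=
  ∫ y, M.grossPayoff (Function.update y i x) (Function.update y i q) i ∂(jointLaw N μ)

/-- The derivative of `interimGross` in the own valuation. -/
def interimSlope (M : DirectMechanism N) (μ : Measure ℝ) (i : Fin N) (q x : ℝ) : ℝ :=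
  ∫ y, M.grossSlope (Function.update y i x) (Function.update y i q) i ∂(jointLaw N μ)

/-- Buyer `i`'s contribution to the virtual surplus under truthful reports: the payoff net of the
information rent. -/
def virtualSurplus (M : DirectMechanism N) (μ : Measure ℝ) (f : ℝ → ℝ) (x : Fin N → ℝ)
    (i : Fin N) : ℝ :=
  M.grossPayoff x x i - invHazard μ f (x i) * M.grossSlope x x i

/-- The allocation rule is measurable, and feasible for all reports in `[lo, hi]`. -/
structure IsFeasible (M : DirectMechanism N) (lo hi : ℝ) : Prop where
  measurable_alloc : ∀ i, Measurable fun x => M.alloc x i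
  feasibleAt : ∀ b : Fin N → ℝ, (∀ i, b i ∈ Icc lo hi) → M.FeasibleAt b

namespace IsFeasible

variable [IsProbabilityMeasure μ]

lemma ae_feasibleAt_update (hM : M.IsFeasible lo hi) (hsupp : ∀ᵐ x ∂μ, x ∈ Icc lo hi) (i : Fin N)
    {q : ℝ} (hq : q ∈ Icc lo hi) :
    ∀ᵐ y ∂(jointLaw N μ), M.FeasibleAt (Function.update y i q) :=
  (ae_forall_mem_Icc hsupp).mono fun _ hy => hM.feasibleAt _ (update_mem hy i hq)

lemma integrable_grossPayoff_update (hM : M.IsFeasible lo hi) (hsupp : ∀ᵐ x ∂μ, x ∈ Icc lo hi)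
    (i : Fin N) {q x : ℝ} (hq : q ∈ Icc lo hi) (hx : 0 ≤ x) :
    Integrable (fun y => M.grossPayoff (Function.update y i x) (Function.update y i q) i)
      (jointLaw N μ) := by
  refine .of_mem_Icc 0 x (measurable_grossPayoff hM.measurable_alloc measurable_update_left
    measurable_update_left i).aemeasurable ?_
  filter_upwards [hM.ae_feasibleAt_update hsupp i hq] with y hy
  have hmem := grossPayoff_mem_Icc (v := Function.update y i x) hy (by rwa [Function.update_self])
  rwa [Function.update_self] at hmem

lemma lipschitzOnWith_interimGross (hM : M.IsFeasible lo hi) (hsupp : ∀ᵐ x ∂μ, x ∈ Icc lo hi)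
    (i : Fin N) {q : ℝ} (hq : q ∈ Icc lo hi) :
    LipschitzOnWith 1 (M.interimGross μ i q) (Ici 0) := by
  refine LipschitzOnWith.of_dist_le_mul fun x hx x' hx' => ?_
  rw [NNReal.coe_one, one_mul, Real.dist_eq x, dist_eq_norm, interimGross, interimGross,
    ← integral_sub (hM.integrable_grossPayoff_update hsupp i hq hx)
      (hM.integrable_grossPayoff_update hsupp i hq hx')]
  refine (norm_integral_le_of_norm_le_const (C := |x - x'|) ?_).trans_eq
    (by rw [probReal_univ, mul_one])
  filter_upwards [hM.ae_feasibleAt_update hsupp i hq] with y hy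
  exact abs_grossPayoff_update_sub_le hy y i x x'

lemma hasDerivAt_interimGross [NullSingletonClass μ] (hM : M.IsFeasible lo hi)
    (hsupp : ∀ᵐ x ∂μ, x ∈ Icc lo hi) (i : Fin N) {q s : ℝ} (hq : q ∈ Icc lo hi) (hs : 0 < s) :
    HasDerivAt (M.interimGross μ i q) (M.interimSlope μ i q s) s := by
  refine (hasDerivAt_integral_of_dominated_loc_of_lip (s := univ) (bound := fun _ => 1)
    Filter.univ_mem (.of_forall fun x => ?_) (hM.integrable_grossPayoff_update hsupp i hq hs.le)
    ?_ ?_ (integrable_const _) ?_).2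
  · exact (measurable_grossPayoff hM.measurable_alloc measurable_update_left
      measurable_update_left i).aestronglyMeasurable
  · exact (measurable_grossSlope hM.measurable_alloc measurable_update_left
      measurable_update_left i).aestronglyMeasurable
  · filter_upwards [hM.ae_feasibleAt_update hsupp i hq] with y hy
    refine LipschitzOnWith.of_dist_le_mul fun x _ x' _ => ?_
    simpa [Real.dist_eq] using abs_grossPayoff_update_sub_le hy y i x x'
  · filter_upwards [ae_forall_ne s] with y hy
    exact M.hasDerivAt_grossPayoff _ i hs.ne' hy

lemma integrable_grossPayoff (hM : M.IsFeasible lo hi) (hlo : 0 ≤ lo)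
    (hsupp : ∀ᵐ x ∂μ, x ∈ Icc lo hi) (i : Fin N) :
    Integrable (fun x => M.grossPayoff x x i) (jointLaw N μ) := by
  refine .of_mem_Icc 0 hi (measurable_grossPayoff hM.measurable_alloc measurable_id
    measurable_id i).aemeasurable ?_
  filter_upwards [ae_forall_mem_Icc hsupp] with y hy
  exact Icc_subset_Icc_right (hy i).2
    (grossPayoff_mem_Icc (hM.feasibleAt y hy) (hlo.trans (hy i).1))

lemma integrable_invHazard_mul_grossSlope (hM : M.IsFeasible lo hi) (h : IsPriorDensity lo hi μ f)
    (i : Fin N) :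
    Integrable (fun x => invHazard μ f (x i) * M.grossSlope x x i) (jointLaw N μ) := by
  refine Integrable.mul_bdd (c := 1)
    ((measurePreserving_eval_jointLaw i).integrable_comp_of_integrable h.integrable_invHazard)
    (measurable_grossSlope hM.measurable_alloc measurable_id measurable_id i).aestronglyMeasurable
    ?_
  filter_upwards [ae_forall_mem_Icc h.ae_mem_Icc] with y hy
  obtain ⟨h0, h1⟩ := grossSlope_mem_Icc (hM.feasibleAt y hy) y i
  rwa [Real.norm_of_nonneg h0]

lemma integrable_virtualSurplus (hM : M.IsFeasible lo hi) (hlo : 0 ≤ lo)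
    (h : IsPriorDensity lo hi μ f) (i : Fin N) :
    Integrable (fun x => M.virtualSurplus μ f x i) (jointLaw N μ) :=
  (hM.integrable_grossPayoff hlo h.ae_mem_Icc i).sub (hM.integrable_invHazard_mul_grossSlope h i)

end IsFeasible

namespace IsAdmissible

lemma isFeasible (hM : M.IsAdmissible lo hi μ) : M.IsFeasible lo hi :=
  ⟨hM.measurable_alloc, fun b hb => ⟨hM.alloc_nonneg b hb, hM.alloc_sum_le_one b hb⟩⟩

variable [IsProbabilityMeasure μ]

lemma interimPayoff_eq (hM : M.IsAdmissible lo hi μ) (hsupp : ∀ᵐ x ∂μ, x ∈ Icc lo hi) (i : Fin N)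
    {q x : ℝ} (hq : q ∈ Icc lo hi) (hx : 0 ≤ x) :
    M.interimPayoff μ i q x = M.interimGross μ i q x
      - ∫ y, M.pay (Function.update y i q) i ∂(jointLaw N μ) :=
  integral_sub (hM.isFeasible.integrable_grossPayoff_update hsupp i hq hx)
    (hM.integrable_interim_pay i q hq)

lemma interimGross_sub_le_interimPayoff_sub (hM : M.IsAdmissible lo hi μ) (hlo : 0 ≤ lo)
    (hsupp : ∀ᵐ x ∂μ, x ∈ Icc lo hi) (i : Fin N) {q x : ℝ} (hq : q ∈ Icc lo hi)
    (hx : x ∈ Icc lo hi) :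
    M.interimGross μ i q x - M.interimGross μ i q q
      ≤ M.interimPayoff μ i x x - M.interimPayoff μ i q q := by
  have hIC := hM.incentive_compatible i x hx q hq
  rw [hM.interimPayoff_eq hsupp i hq (hlo.trans hx.1)] at hIC
  rw [hM.interimPayoff_eq hsupp i hq (hlo.trans hq.1)]
  linarith

lemma integral_interimPayoff [NullSingletonClass μ] (hM : M.IsAdmissible lo hi μ) (hlo : 0 ≤ lo)
    (hsupp : ∀ᵐ x ∂μ, x ∈ Icc lo hi) (i : Fin N) :
    ∫ x, M.interimPayoff μ i x x ∂μ = M.interimPayoff μ i lo lo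
      + ∫ x in lo..hi, M.interimSlope μ i x x * (1 - cdf μ x) :=
  integral_eq_add_integral_mul_one_sub_cdf_of_envelope hsupp
    (fun _ hq => (hM.isFeasible.lipschitzOnWith_interimGross hsupp i hq).mono
      fun _ hx => hlo.trans hx.1)
    (fun _ hs => hM.isFeasible.hasDerivAt_interimGross hsupp i (Ioo_subset_Icc_self hs)
      (hlo.trans_lt hs.1))
    fun _ hq _ hx => hM.interimGross_sub_le_interimPayoff_sub hlo hsupp i hq hx

lemma integral_pay (hM : M.IsAdmissible lo hi μ) (hlo : 0 ≤ lo) (h : IsPriorDensity lo hi μ f)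
    (i : Fin N) :
    ∫ x, M.pay x i ∂(jointLaw N μ)
      = ∫ x, M.virtualSurplus μ f x i ∂(jointLaw N μ) - M.interimPayoff μ i lo lo := by
  have := h.nullSingletonClass
  have hgross := hM.isFeasible.integrable_grossPayoff hlo h.ae_mem_Icc i
  have hrent := hM.isFeasible.integrable_invHazard_mul_grossSlope h i
  have hpay := hM.integrable_pay i
  have hrent_eq : ∫ x, invHazard μ f (x i) * M.grossSlope x x i ∂(jointLaw N μ)
      = ∫ x in lo..hi, M.interimSlope μ i x x * (1 - cdf μ x) := by
    rw [integral_jointLaw_eq_integral_update i hrent, ← h.integral_mul_invHazard]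
    simp only [Function.update_self, integral_const_mul, interimSlope, mul_comm]
  have hpayoff : ∫ x, M.grossPayoff x x i ∂(jointLaw N μ) - ∫ x, M.pay x i ∂(jointLaw N μ)
      = ∫ x, M.interimPayoff μ i x x ∂μ := by
    rw [← integral_sub hgross hpay]
    exact integral_jointLaw_eq_integral_update i (hgross.sub hpay)
  simp only [virtualSurplus, integral_sub hgross hrent, hrent_eq]
  linarith [hM.integral_interimPayoff hlo h.ae_mem_Icc i]

end IsAdmissible

/-- The mechanism that never allocates the good and never charges a payment. -/
def inactive (N : ℕ) : DirectMechanism N where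
  alloc _ _ := 0
  pay _ _ := 0

lemma interimPayoff_inactive (i : Fin N) (q x : ℝ) :
    (inactive N).interimPayoff μ i q x = outsideOption N μ i x := by
  simp [inactive, interimPayoff, outsideOption, grossPayoff]

lemma isAdmissible_inactive : (inactive N).IsAdmissible lo hi μ where
  measurable_alloc _ := measurable_const
  measurable_pay _ := measurable_const
  integrable_pay _ := integrable_zero _ _ _
  integrable_interim_pay _ _ _ := integrable_zero _ _ _
  alloc_nonneg _ _ _ := le_rfl
  alloc_sum_le_one _ _ := by simp [inactive]
  incentive_compatible _ _ _ _ _ := by simp only [interimPayoff_inactive, le_refl]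
  individually_rational _ _ _ := by simp only [interimPayoff_inactive, le_refl]

end DirectMechanism

section TopEntries

variable {ι α : Type*}

/-- `a` and `b` index the two highest entries of `x` in `S`, in this order and without ties. -/
structure IsTopTwo [Preorder α] (x : ι → α) (S : Finset ι) (a b : ι) : Prop where
  first_mem : a ∈ S
  second_mem : b ∈ S
  second_lt_first : x b < x a
  le_second : ∀ k ∈ S, k ≠ a → x k ≤ x b

/-- `a`, `b` and `c` index the three highest entries of `x`, in this order and without ties. -/
structure IsTopThree [Preorder α] (x : ι → α) (a b c : ι) : Prop where
  second_lt_first : x b < x a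
  third_lt_second : x c < x b
  le_third : ∀ k, k ≠ a → k ≠ b → x k ≤ x c

namespace IsTopTwo

variable [Preorder α] {x : ι → α} {S : Finset ι} {a b : ι}

lemma first_ne_second (h : IsTopTwo x S a b) : a ≠ b :=
  (ne_of_apply_ne x h.second_lt_first.ne).symm

lemma le_first (h : IsTopTwo x S a b) {k : ι} (hk : k ∈ S) : x k ≤ x a := by
  rcases eq_or_ne k a with rfl | hka
  · exact le_rfl
  · exact (h.le_second k hk hka).trans h.second_lt_first.le

lemma erase [DecidableEq ι] (h : IsTopTwo x S a b) {j : ι} (ha : j ≠ a) (hb : j ≠ b) :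
    IsTopTwo x (S.erase j) a b :=
  ⟨Finset.mem_erase.2 ⟨ha.symm, h.first_mem⟩, Finset.mem_erase.2 ⟨hb.symm, h.second_mem⟩,
    h.second_lt_first, fun k hk => h.le_second k (Finset.mem_of_mem_erase hk)⟩

end IsTopTwo

namespace IsTopThree

variable {x : ι → α} {a b c : ι}

section Preorder

variable [Preorder α]

lemma first_ne_second (h : IsTopThree x a b c) : a ≠ b :=
  (ne_of_apply_ne x h.second_lt_first.ne).symm

lemma second_ne_third (h : IsTopThree x a b c) : b ≠ c :=
  (ne_of_apply_ne x h.third_lt_second.ne).symm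

lemma first_ne_third (h : IsTopThree x a b c) : a ≠ c :=
  (ne_of_apply_ne x (h.third_lt_second.trans h.second_lt_first).ne).symm

lemma le_second (h : IsTopThree x a b c) {k : ι} (hk : k ≠ a) : x k ≤ x b := by
  rcases eq_or_ne k b with rfl | hkb
  · exact le_rfl
  · exact (h.le_third k hk hkb).trans h.third_lt_second.le

variable [Fintype ι]

lemma isTopTwo_univ (h : IsTopThree x a b c) : IsTopTwo x Finset.univ a b :=
  ⟨Finset.mem_univ _, Finset.mem_univ _, h.second_lt_first, fun _ _ => h.le_second⟩

variable [DecidableEq ι]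

lemma isTopTwo_erase_first (h : IsTopThree x a b c) : IsTopTwo x (Finset.univ.erase a) b c :=
  ⟨by simp [h.first_ne_second.symm], by simp [h.first_ne_third.symm], h.third_lt_second,
    fun k hk => h.le_third k (Finset.ne_of_mem_erase hk)⟩

lemma isTopTwo_erase_second (h : IsTopThree x a b c) : IsTopTwo x (Finset.univ.erase b) a c :=
  ⟨by simp [h.first_ne_second], by simp [h.second_ne_third.symm],
    h.third_lt_second.trans h.second_lt_first,
    fun k hk hka => h.le_third k hka (Finset.ne_of_mem_erase hk)⟩

end Preorder

lemma unique [LinearOrder α] (hx : Function.Injective x) {a' b' c' : ι}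
    (h : IsTopThree x a b c) (h' : IsTopThree x a' b' c') : a = a' ∧ b = b' ∧ c = c' := by
  obtain rfl : a = a' := by
    by_contra hne
    exact ((h.le_second (Ne.symm hne)).trans_lt h.second_lt_first).not_ge
      ((h'.le_second hne).trans_lt h'.second_lt_first).le
  obtain rfl : b = b' := by
    by_contra hne
    exact ((h.le_third _ h'.first_ne_second.symm (Ne.symm hne)).trans_lt h.third_lt_second).not_ge
      ((h'.le_third _ h.first_ne_second.symm hne).trans_lt h'.third_lt_second).le
  exact ⟨rfl, rfl, hx ((h'.le_third c h.first_ne_third.symm h.second_ne_third.symm).antisymm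
    (h.le_third c' h'.first_ne_third.symm h'.second_ne_third.symm))⟩

end IsTopThree

section LinearOrder

variable [LinearOrder α] {x y : ι → α} {S : Finset ι} {a b i m n : ι} {q : α}

lemma exists_isTopTwo (hx : Function.Injective x) (hS : S.Nontrivial) :
    ∃ a b, IsTopTwo x S a b := by
  classical
  obtain ⟨a, ha, hmax⟩ := S.exists_max_image x hS.nonempty
  obtain ⟨b, hb, hmax'⟩ := (S.erase a).exists_max_image x ((Finset.erase_nonempty ha).2 hS)
  obtain ⟨hba, hbS⟩ := Finset.mem_erase.1 hb
  exact ⟨a, b, ha, hbS, (hmax b hbS).lt_of_ne (hx.ne hba),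
    fun k hk hka => hmax' k (Finset.mem_erase.2 ⟨hka, hk⟩)⟩

variable [Fintype ι]

lemma IsTopTwo.exists_isTopThree (h : IsTopTwo x Finset.univ a b) (hx : Function.Injective x)
    {k : ι} (hka : k ≠ a) (hkb : k ≠ b) : ∃ c, IsTopThree x a b c := by
  classical
  obtain ⟨c, hc, hmax⟩ := ((Finset.univ.erase a).erase b).exists_max_image x
    ⟨k, by simp [hka, hkb]⟩
  obtain ⟨hcb, hca⟩ : c ≠ b ∧ c ≠ a := by simpa using hc
  exact ⟨c, h.second_lt_first, (h.le_second c (Finset.mem_univ c) hca).lt_of_ne (hx.ne hcb),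
    fun k hka hkb => hmax k (by simp [hka, hkb])⟩

namespace IsTopTwo

variable [DecidableEq ι]

lemma isTopThree_update_of_first_lt (h : IsTopTwo y (Finset.univ.erase i) m n) (hq : y m < q) :
    IsTopThree (Function.update y i q) i m n := by
  have hm := Finset.ne_of_mem_erase h.first_mem
  have hn := Finset.ne_of_mem_erase h.second_mem
  refine ⟨by simpa [hm] using hq, by simpa [hm, hn] using h.second_lt_first, fun k hki hkm => ?_⟩
  simpa [hn, hki] using h.le_second k (by simp [hki]) hkm

lemma isTopThree_update_of_second_lt_of_lt_first (h : IsTopTwo y (Finset.univ.erase i) m n)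
    (hnq : y n < q) (hqm : q < y m) : IsTopThree (Function.update y i q) m i n := by
  have hm := Finset.ne_of_mem_erase h.first_mem
  have hn := Finset.ne_of_mem_erase h.second_mem
  refine ⟨by simpa [hm] using hqm, by simpa [hn] using hnq, fun k hkm hki => ?_⟩
  simpa [hn, hki] using h.le_second k (by simp [hki]) hkm

lemma exists_isTopThree_update_of_lt_second (h : IsTopTwo y (Finset.univ.erase i) m n)
    (hy : Function.Injective (Function.update y i q)) (hq : q < y n) :
    ∃ t, IsTopThree (Function.update y i q) m n t := by
  have hm := Finset.ne_of_mem_erase h.first_mem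
  have hn := Finset.ne_of_mem_erase h.second_mem
  have htop : IsTopTwo (Function.update y i q) Finset.univ m n := by
    refine ⟨Finset.mem_univ m, Finset.mem_univ n, by simpa [hm, hn] using h.second_lt_first,
      fun k _ hkm => ?_⟩
    rcases eq_or_ne k i with rfl | hki
    · simpa [hn] using hq.le
    · simpa [hn, hki] using h.le_second k (by simp [hki]) hkm
  exact htop.exists_isTopThree hy hm.symm hn.symm

end IsTopTwo

end LinearOrder

end TopEntries

section OrderStatistics

variable {x : Fin N → ℝ}

/-- The ranking that `orderStat` reads off. -/
def sortedRanking (x : Fin N → ℝ) : Equiv.Perm (Fin N) :=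
  Tuple.sort fun i => OrderDual.toDual (x i)

lemma orderStat_eq (x : Fin N → ℝ) (k : Fin N) : orderStat x k = x (sortedRanking x k) := rfl

lemma antitone_orderStat (x : Fin N → ℝ) : Antitone (orderStat x) := fun _ _ hkl =>
  OrderDual.toDual_le_toDual.1 (Tuple.monotone_sort (fun i => OrderDual.toDual (x i)) hkl)

lemma mem_rankings {σ : Equiv.Perm (Fin N)} : σ ∈ rankings x ↔ Antitone fun k => x (σ k) := by
  simp [rankings]

lemma sortedRanking_mem_rankings (x : Fin N → ℝ) : sortedRanking x ∈ rankings x :=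
  mem_rankings.2 (antitone_orderStat x)

lemma orderStat_eq_of_mem_rankings {σ : Equiv.Perm (Fin N)} (hσ : σ ∈ rankings x) (k : Fin N) :
    orderStat x k = x (σ k) :=
  (congrFun (Tuple.unique_antitone (mem_rankings.1 hσ) (antitone_orderStat x)) k).symm

lemma rankings_eq_singleton (hx : Function.Injective x) : rankings x = {sortedRanking x} :=
  Finset.eq_singleton_iff_unique_mem.2 ⟨sortedRanking_mem_rankings x, fun _ hσ =>
    Equiv.ext fun k => (hx (orderStat_eq_of_mem_rankings hσ k)).symm⟩

lemma measurableSet_mem_rankings (σ : Equiv.Perm (Fin N)) :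
    MeasurableSet {x : Fin N → ℝ | σ ∈ rankings x} := by
  simp only [mem_rankings, Antitone, ofPred_forall]
  exact .iInter fun k => .iInter fun l => .iInter fun _ =>
    measurableSet_le (measurable_pi_apply _) (measurable_pi_apply _)

lemma measurable_orderStat (k : Fin N) : Measurable fun x : Fin N → ℝ => orderStat x k := by
  refine measurable_of_Ici fun c => ?_
  have hpre : (fun x : Fin N → ℝ => orderStat x k) ⁻¹' Ici c
      = ⋃ σ : Equiv.Perm (Fin N), {x | σ ∈ rankings x} ∩ {x | c ≤ x (σ k)} := by
    ext x
    refine ⟨fun hc => mem_iUnion.2 ⟨sortedRanking x, sortedRanking_mem_rankings x, hc⟩,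
      fun hx => ?_⟩
    obtain ⟨σ, hσ, hc⟩ := mem_iUnion.1 hx
    exact hc.trans_eq (orderStat_eq_of_mem_rankings hσ k).symm
  rw [hpre]
  exact .iUnion fun σ => (measurableSet_mem_rankings σ).inter
    (measurableSet_le measurable_const (measurable_pi_apply _))

section Positions

variable [NeZero N]

lemma val_one_of_three_le (hN : 3 ≤ N) : ((1 : Fin N) : ℕ) = 1 := Nat.mod_eq_of_lt (by lia)

lemma val_two_of_three_le (hN : 3 ≤ N) : ((2 : Fin N) : ℕ) = 2 := Nat.mod_eq_of_lt (by lia)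

lemma orderStat_two_le_orderStat_one (hN : 3 ≤ N) (x : Fin N → ℝ) :
    orderStat x 2 ≤ orderStat x 1 :=
  antitone_orderStat x (by rw [Fin.le_def, val_one_of_three_le hN, val_two_of_three_le hN]; lia)

lemma isTopThree_sortedRanking (hN : 3 ≤ N) (hx : Function.Injective x) :
    IsTopThree x (sortedRanking x 0) (sortedRanking x 1) (sortedRanking x 2) := by
  have h1 := val_one_of_three_le hN
  have h2 := val_two_of_three_le hN
  have hanti : StrictAnti (orderStat x) :=
    (antitone_orderStat x).strictAnti_of_injective (hx.comp (sortedRanking x).injective)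
  refine ⟨hanti (by rw [Fin.lt_def, Fin.val_zero]; lia), hanti (by rw [Fin.lt_def]; lia),
    fun k hk0 hk1 => ?_⟩
  obtain ⟨l, rfl⟩ := (sortedRanking x).surjective k
  have hl0 : (l : ℕ) ≠ 0 := fun h => hk0 (congrArg _ (Fin.ext (by rw [h, Fin.val_zero])))
  have hl1 : (l : ℕ) ≠ 1 := fun h => hk1 (congrArg _ (Fin.ext (by rw [h, h1])))
  exact hanti.antitone (by rw [Fin.le_def]; lia)

end Positions

end OrderStatistics

section VirtualAuction

variable {μ : Measure ℝ} {f : ℝ → ℝ} {x : Fin N → ℝ} {S : Finset (Fin N)} {i a b c j : Fin N}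

lemma secondAuctionPayoff_eq_max (ha : a ∈ S) (h0 : 0 ≤ x a) (hle : ∀ k ∈ S, x k ≤ x a)
    (i : Fin N) : secondAuctionPayoff x S i = max (x i - x a) 0 := by
  rw [secondAuctionPayoff, fold_max_eq_of_forall_le ha h0 hle]

/-- Buyer `i`'s payoff in the second auction against the rivals `S`, net of his information rent
there. -/
def virtualPayoff (μ : Measure ℝ) (f : ℝ → ℝ) (x : Fin N → ℝ) (S : Finset (Fin N)) (i : Fin N) :
    ℝ :=
  secondAuctionPayoff x S i - invHazard μ f (x i) * secondAuctionSlope x S i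

/-- The virtual surplus that the buyers in `S` obtain from a second auction among themselves. -/
def virtualAuctionSurplus (μ : Measure ℝ) (f : ℝ → ℝ) (x : Fin N → ℝ) (S : Finset (Fin N)) : ℝ :=
  ∑ i ∈ S, virtualPayoff μ f x (S.erase i) i

/-- The effect on the virtual surplus of giving the first good to buyer `j`: his virtual value is
gained, and he is withdrawn from the second auction. -/
def virtualGain (μ : Measure ℝ) (f : ℝ → ℝ) (x : Fin N → ℝ) (j : Fin N) : ℝ :=
  virtualValue μ f (x j) + virtualAuctionSurplus μ f x (Finset.univ.erase j)
    - virtualAuctionSurplus μ f x Finset.univ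

lemma virtualPayoff_eq_zero (ha : a ∈ S) (hle : x i ≤ x a) : virtualPayoff μ f x S i = 0 := by
  have hi : x i ≤ S.fold max 0 x := (Finset.le_fold_max _).2 (.inr ⟨a, ha, hle⟩)
  rw [virtualPayoff, secondAuctionPayoff, secondAuctionSlope, if_neg hi.not_gt,
    max_eq_right (sub_nonpos.2 hi), mul_zero, sub_zero]

lemma virtualPayoff_eq_virtualValue_sub (ha : a ∈ S) (h0 : 0 ≤ x a) (hle : ∀ k ∈ S, x k ≤ x a)
    (hlt : x a < x i) : virtualPayoff μ f x S i = virtualValue μ f (x i) - x a := by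
  rw [virtualPayoff, secondAuctionPayoff_eq_max ha h0 hle, secondAuctionSlope,
    fold_max_eq_of_forall_le ha h0 hle, if_pos hlt, max_eq_left (sub_nonneg.2 hlt.le),
    virtualValue_eq_sub_invHazard, mul_one, sub_right_comm]

lemma IsTopTwo.virtualAuctionSurplus_eq (h : IsTopTwo x S a b) (h0 : 0 ≤ x b) :
    virtualAuctionSurplus μ f x S = virtualValue μ f (x a) - x b := by
  rw [virtualAuctionSurplus, Finset.sum_eq_single_of_mem a h.first_mem fun i hi hia =>
    virtualPayoff_eq_zero (Finset.mem_erase.2 ⟨hia.symm, h.first_mem⟩) (h.le_first hi)]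
  refine virtualPayoff_eq_virtualValue_sub
    (Finset.mem_erase.2 ⟨h.first_ne_second.symm, h.second_mem⟩) h0 (fun k hk => ?_)
    h.second_lt_first
  exact h.le_second k (Finset.mem_of_mem_erase hk) (Finset.ne_of_mem_erase hk)

namespace IsTopThree

lemma virtualGain_first (h : IsTopThree x a b c) (h0 : ∀ k, 0 ≤ x k) :
    virtualGain μ f x a = virtualValue μ f (x b) + x b - x c := by
  rw [virtualGain, h.isTopTwo_univ.virtualAuctionSurplus_eq (h0 b),
    h.isTopTwo_erase_first.virtualAuctionSurplus_eq (h0 c)]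
  ring

lemma virtualGain_second (h : IsTopThree x a b c) (h0 : ∀ k, 0 ≤ x k) :
    virtualGain μ f x b = virtualValue μ f (x b) + x b - x c := by
  rw [virtualGain, h.isTopTwo_univ.virtualAuctionSurplus_eq (h0 b),
    h.isTopTwo_erase_second.virtualAuctionSurplus_eq (h0 c)]
  ring

lemma virtualGain_of_ne (h : IsTopThree x a b c) (h0 : ∀ k, 0 ≤ x k) (hja : j ≠ a) (hjb : j ≠ b) :
    virtualGain μ f x j = virtualValue μ f (x j) := by
  rw [virtualGain, h.isTopTwo_univ.virtualAuctionSurplus_eq (h0 b),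
    (h.isTopTwo_univ.erase hja hjb).virtualAuctionSurplus_eq (h0 b), add_sub_cancel_right]

variable [NeZero N]

lemma eq_sortedRanking (h : IsTopThree x a b c) (hN : 3 ≤ N) (hx : Function.Injective x) :
    a = sortedRanking x 0 ∧ b = sortedRanking x 1 ∧ c = sortedRanking x 2 :=
  h.unique hx (isTopThree_sortedRanking hN hx)

lemma marginalRevenue_eq (h : IsTopThree x a b c) (hN : 3 ≤ N) (hx : Function.Injective x) :
    marginalRevenue μ f x = virtualValue μ f (x b) + x b - x c := by
  obtain ⟨-, rfl, rfl⟩ := h.eq_sortedRanking hN hx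
  rfl

end IsTopThree

variable [NeZero N]

lemma virtualGain_sortedRanking_one (hN : 3 ≤ N) (hx : Function.Injective x) (h0 : ∀ k, 0 ≤ x k) :
    virtualGain μ f x (sortedRanking x 1) = marginalRevenue μ f x :=
  (isTopThree_sortedRanking hN hx).virtualGain_second h0

lemma virtualGain_le_marginalRevenue {s : Set ℝ} (hψ : MonotoneOn (virtualValue μ f) s)
    (hN : 3 ≤ N) (hx : Function.Injective x) (h0 : ∀ k, 0 ≤ x k) (hs : ∀ k, x k ∈ s) (j : Fin N) :
    virtualGain μ f x j ≤ marginalRevenue μ f x := by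
  have htop := isTopThree_sortedRanking hN hx
  rw [htop.marginalRevenue_eq hN hx]
  by_cases hj0 : j = sortedRanking x 0
  · rw [hj0, htop.virtualGain_first h0]
  by_cases hj1 : j = sortedRanking x 1
  · rw [hj1, htop.virtualGain_second h0]
  rw [htop.virtualGain_of_ne h0 hj0 hj1]
  linarith [hψ (hs j) (hs _) (htop.le_second hj0), htop.third_lt_second]

end VirtualAuction

section Revenue

variable {M : DirectMechanism N} {μ : Measure ℝ} {f : ℝ → ℝ} {lo hi : ℝ}

namespace DirectMechanism

lemma virtualSurplus_eq_average (M : DirectMechanism N) (x : Fin N → ℝ) (i : Fin N) :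
    M.virtualSurplus μ f x i
      = M.average x i (virtualValue μ f (x i)) fun S => virtualPayoff μ f x S i := by
  simp only [virtualSurplus, grossPayoff_eq_average, grossSlope, ← average_const_mul,
    ← average_sub, mul_one, virtualValue_eq_sub_invHazard, virtualPayoff]

lemma sum_virtualSurplus (M : DirectMechanism N) (x : Fin N → ℝ) :
    ∑ i, M.virtualSurplus μ f x i
      = virtualAuctionSurplus μ f x Finset.univ + ∑ j, M.alloc x j * virtualGain μ f x j := by
  have hswap : ∑ i, ∑ j ∈ Finset.univ.erase i,
        M.alloc x j * virtualPayoff μ f x ((Finset.univ.erase i).erase j) i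
      = ∑ j, M.alloc x j * virtualAuctionSurplus μ f x (Finset.univ.erase j) := by
    simp only [virtualAuctionSurplus, Finset.mul_sum]
    rw [Finset.sum_comm' (t' := Finset.univ) (s' := Finset.univ.erase) fun i j => by simp [eq_comm]]
    exact Finset.sum_congr rfl fun j _ => Finset.sum_congr rfl fun i _ => by
      rw [Finset.erase_right_comm]
  simp only [virtualSurplus_eq_average, average, Finset.sum_add_distrib, hswap, ← Finset.mul_sum,
    virtualGain, mul_add, mul_sub, Finset.sum_sub_distrib, ← Finset.sum_mul]
  simp only [virtualAuctionSurplus]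
  ring

lemma sum_virtualSurplus_sub_inactive (M : DirectMechanism N) (x : Fin N → ℝ) :
    ∑ i, (M.virtualSurplus μ f x i - (inactive N).virtualSurplus μ f x i)
      = ∑ j, M.alloc x j * virtualGain μ f x j := by
  rw [Finset.sum_sub_distrib, sum_virtualSurplus, sum_virtualSurplus]
  simp [inactive]

variable [IsProbabilityMeasure μ]

lemma IsFeasible.integrable_virtualSurplus_sub_inactive (hM : M.IsFeasible lo hi) (hlo : 0 ≤ lo)
    (h : IsPriorDensity lo hi μ f) (i : Fin N) :
    Integrable (fun x => M.virtualSurplus μ f x i - (inactive N).virtualSurplus μ f x i)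
      (jointLaw N μ) :=
  (hM.integrable_virtualSurplus hlo h i).sub
    ((isAdmissible_inactive (μ := μ)).isFeasible.integrable_virtualSurplus hlo h i)

lemma IsFeasible.integrable_sum_alloc_mul_virtualGain (hM : M.IsFeasible lo hi) (hlo : 0 ≤ lo)
    (h : IsPriorDensity lo hi μ f) :
    Integrable (fun x => ∑ j, M.alloc x j * virtualGain μ f x j) (jointLaw N μ) := by
  simp only [← sum_virtualSurplus_sub_inactive]
  exact integrable_finsetSum _ fun i _ => hM.integrable_virtualSurplus_sub_inactive hlo h i

namespace IsAdmissible

lemma integral_pay_eq_sub_outsideOption (hM : M.IsAdmissible lo hi μ) (hlo : 0 ≤ lo)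
    (h : IsPriorDensity lo hi μ f) (i : Fin N) :
    ∫ x, M.pay x i ∂(jointLaw N μ)
      = ∫ x, (M.virtualSurplus μ f x i - (inactive N).virtualSurplus μ f x i) ∂(jointLaw N μ)
        - (M.interimPayoff μ i lo lo - outsideOption N μ i lo) := by
  have hinactive : (inactive N).IsAdmissible lo hi μ := isAdmissible_inactive
  have hzero : ∫ x, (inactive N).pay x i ∂(jointLaw N μ) = 0 := integral_zero _ _
  rw [hinactive.integral_pay hlo h, interimPayoff_inactive] at hzero
  rw [hM.integral_pay hlo h, integral_sub (hM.isFeasible.integrable_virtualSurplus hlo h i)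
    (hinactive.isFeasible.integrable_virtualSurplus hlo h i)]
  linarith

lemma revenue_eq (hM : M.IsAdmissible lo hi μ) (hlo : 0 ≤ lo) (h : IsPriorDensity lo hi μ f) :
    M.revenue μ = ∫ x, ∑ j, M.alloc x j * virtualGain μ f x j ∂(jointLaw N μ)
      - ∑ i, (M.interimPayoff μ i lo lo - outsideOption N μ i lo) := by
  simp only [← sum_virtualSurplus_sub_inactive (μ := μ) (f := f)]
  rw [revenue, integral_finsetSum _ fun i _ => hM.integrable_pay i,
    integral_finsetSum _ fun i _ => hM.isFeasible.integrable_virtualSurplus_sub_inactive hlo h i,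
    ← Finset.sum_sub_distrib]
  exact Finset.sum_congr rfl fun i _ => hM.integral_pay_eq_sub_outsideOption hlo h i

end IsAdmissible

end DirectMechanism

variable [NeZero N]

lemma IsPriorDensity.measurable_marginalRevenue (h : IsPriorDensity lo hi μ f) :
    Measurable fun x : Fin N → ℝ => marginalRevenue μ f x :=
  ((h.measurable_virtualValue.comp (measurable_orderStat 1)).add (measurable_orderStat 1)).sub
    (measurable_orderStat 2)

variable [IsProbabilityMeasure μ]

lemma IsPriorDensity.integrable_max_marginalRevenue (h : IsPriorDensity lo hi μ f) (hlo : 0 ≤ lo) :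
    Integrable (fun x : Fin N → ℝ => max (marginalRevenue μ f x) 0) (jointLaw N μ) := by
  refine .of_mem_Icc 0 (2 * hi) (h.measurable_marginalRevenue.max measurable_const).aemeasurable ?_
  filter_upwards [ae_forall_mem_Icc h.ae_mem_Icc] with x hx
  have h1 : orderStat x 1 ≤ hi := (hx _).2
  have h2 : lo ≤ orderStat x 2 := (hx _).1
  refine ⟨le_max_right _ _, max_le ?_ (by linarith [h.lo_lt_hi])⟩
  rw [marginalRevenue, virtualValue_eq_sub_invHazard]
  linarith [h.invHazard_nonneg (orderStat x 1)]

lemma DirectMechanism.IsAdmissible.revenue_le (hM : M.IsAdmissible lo hi μ) (hlo : 0 ≤ lo)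
    (h : IsPriorDensity lo hi μ f) (hψ : MonotoneOn (virtualValue μ f) (Icc lo hi)) (hN : 3 ≤ N) :
    M.revenue μ ≤ ∫ x, max (marginalRevenue μ f x) 0 ∂(jointLaw N μ) := by
  have := h.nullSingletonClass
  have hrent : 0 ≤ ∑ i, (M.interimPayoff μ i lo lo - outsideOption N μ i lo) :=
    Finset.sum_nonneg fun i _ => sub_nonneg.2
      (hM.individually_rational i lo (left_mem_Icc.2 h.lo_lt_hi.le))
  rw [hM.revenue_eq hlo h]
  refine (sub_le_self _ hrent).trans (integral_mono_ae
    (hM.isFeasible.integrable_sum_alloc_mul_virtualGain hlo h)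
    (h.integrable_max_marginalRevenue hlo) ?_)
  filter_upwards [ae_forall_mem_Icc h.ae_mem_Icc, ae_injective] with x hx hinj
  calc ∑ j, M.alloc x j * virtualGain μ f x j
      ≤ ∑ j, M.alloc x j * max (marginalRevenue μ f x) 0 :=
        Finset.sum_le_sum fun j _ => mul_le_mul_of_nonneg_left
          ((virtualGain_le_marginalRevenue hψ hN hinj (fun k => hlo.trans (hx k).1) hx j).trans
            (le_max_left _ _)) (hM.alloc_nonneg x hx j)
    _ = (∑ j, M.alloc x j) * max (marginalRevenue μ f x) 0 := (Finset.sum_mul _ _ _).symm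
    _ ≤ max (marginalRevenue μ f x) 0 :=
        mul_le_of_le_one_left (le_max_right _ _) (hM.alloc_sum_le_one x hx)

end Revenue

section RankAverage

variable {x : Fin N → ℝ}

/-- The expectation of `r` at the position of buyer `i`, when ties in `x` are broken uniformly. -/
def rankAverage (x r : Fin N → ℝ) (i : Fin N) : ℝ :=
  (∑ σ ∈ rankings x, r (σ⁻¹ i)) / (rankings x).card

lemma card_rankings_pos (x : Fin N → ℝ) : (0 : ℝ) < (rankings x).card :=
  Nat.cast_pos.2 (Finset.card_pos.2 ⟨_, sortedRanking_mem_rankings x⟩)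

lemma rankAverage_of_injective (hx : Function.Injective x) (r : Fin N → ℝ) (i : Fin N) :
    rankAverage x r i = r ((sortedRanking x)⁻¹ i) := by
  rw [rankAverage, rankings_eq_singleton hx, Finset.sum_singleton, Finset.card_singleton,
    Nat.cast_one, div_one]

lemma rankAverage_mem_Icc {r : Fin N → ℝ} {c d : ℝ} (hr : ∀ k, r k ∈ Icc c d) (i : Fin N) :
    rankAverage x r i ∈ Icc c d := by
  rw [rankAverage, mem_Icc, le_div_iff₀' (card_rankings_pos x), div_le_iff₀' (card_rankings_pos x),
    ← nsmul_eq_mul, ← nsmul_eq_mul]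
  exact ⟨Finset.card_nsmul_le_sum _ _ _ fun σ _ => (hr _).1,
    Finset.sum_le_card_nsmul _ _ _ fun σ _ => (hr _).2⟩

lemma sum_rankAverage (x r : Fin N → ℝ) : ∑ i, rankAverage x r i = ∑ k, r k := by
  simp only [rankAverage]
  rw [← Finset.sum_div, div_eq_iff (card_rankings_pos x).ne', Finset.sum_comm, mul_comm,
    ← nsmul_eq_mul, ← Finset.sum_const]
  exact Finset.sum_congr rfl fun σ _ => Equiv.sum_comp σ⁻¹ r

lemma measurable_sum_rankings {r : Equiv.Perm (Fin N) → (Fin N → ℝ) → ℝ}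
    (hr : ∀ σ, Measurable (r σ)) : Measurable fun x => ∑ σ ∈ rankings x, r σ x := by
  classical
  have hfilter : ∀ x, ∑ σ ∈ rankings x, r σ x = ∑ σ, if σ ∈ rankings x then r σ x else 0 :=
    fun x => by rw [← Finset.sum_filter, Finset.filter_univ_mem]
  simp only [hfilter]
  exact Finset.measurable_fun_sum _ fun σ _ =>
    Measurable.ite (measurableSet_mem_rankings σ) (hr σ) measurable_const

lemma measurable_rankAverage {r : (Fin N → ℝ) → Fin N → ℝ} (hr : ∀ k, Measurable fun x => r x k)
    (i : Fin N) : Measurable fun x => rankAverage x (r x) i := by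
  have hcard : Measurable fun x : Fin N → ℝ => ((rankings x).card : ℝ) := by
    simp only [Finset.cast_card]
    exact measurable_sum_rankings fun _ => measurable_const
  exact (measurable_sum_rankings fun σ => hr (σ⁻¹ i)).div hcard

end RankAverage

section SecondBidder

variable {lo hi : ℝ} {μ : Measure ℝ} {f : ℝ → ℝ} [NeZero N] {x : Fin N → ℝ}

lemma secondBidderMechanism_alloc (x : Fin N → ℝ) (i : Fin N) :
    (secondBidderMechanism N lo hi μ f).alloc x i = rankAverage x (rankAlloc μ f x) i := rfl

lemma secondBidderMechanism_pay (x : Fin N → ℝ) (i : Fin N) :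
    (secondBidderMechanism N lo hi μ f).pay x i = rankAverage x (rankPay lo hi μ f x) i := rfl

lemma rankAlloc_mem_Icc (x : Fin N → ℝ) (k : Fin N) : rankAlloc μ f x k ∈ Icc 0 1 := by
  rw [rankAlloc]
  split_ifs <;> simp

lemma sum_rankAlloc_le_one (x : Fin N → ℝ) : ∑ k, rankAlloc μ f x k ≤ 1 := by
  rw [Finset.sum_eq_single_of_mem (f := rankAlloc μ f x) 1 (Finset.mem_univ _) fun k _ hk =>
    if_neg fun hk' => hk hk'.2]
  exact (rankAlloc_mem_Icc x 1).2

lemma feasibleAt_secondBidderMechanism (x : Fin N → ℝ) :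
    (secondBidderMechanism N lo hi μ f).FeasibleAt x :=
  ⟨fun i => (rankAverage_mem_Icc (rankAlloc_mem_Icc x) i).1,
    (sum_rankAverage x _).trans_le (sum_rankAlloc_le_one x)⟩

namespace IsPriorDensity

lemma measurable_rankAlloc (h : IsPriorDensity lo hi μ f) (k : Fin N) :
    Measurable fun x : Fin N → ℝ => rankAlloc μ f x k :=
  Measurable.ite ((measurableSet_le measurable_const h.measurable_marginalRevenue).inter
    (.const _)) measurable_const measurable_const

lemma isFeasible_secondBidderMechanism (h : IsPriorDensity lo hi μ f) :
    (secondBidderMechanism N lo hi μ f).IsFeasible lo hi :=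
  ⟨measurable_rankAverage h.measurable_rankAlloc, fun b _ => feasibleAt_secondBidderMechanism b⟩

variable [IsProbabilityMeasure μ]

lemma measurable_rankPay (h : IsPriorDensity lo hi μ f) (hlo : 0 ≤ lo) (k : Fin N) :
    Measurable fun x : Fin N → ℝ => rankPay lo hi μ f x k := by
  have hthr : Measurable fun x : Fin N → ℝ => threshold lo hi μ f (orderStat x 2) :=
    (h.measurable_threshold hlo).comp (measurable_orderStat 2)
  refine .ite (measurableSet_le measurable_const h.measurable_marginalRevenue)
    (.ite (measurableSet_lt (h.measurable_virtualValue.comp (measurable_orderStat 2))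
      measurable_const) ?_ ?_) measurable_const
  · exact .ite (.const _) (hthr.sub (measurable_orderStat 2))
      (.ite (.const _) hthr measurable_const)
  · exact .ite (.const _) (measurable_orderStat 2) measurable_const

lemma rankPay_eq (h : IsPriorDensity lo hi μ f) (hlo : 0 ≤ lo) (hN : 3 ≤ N)
    (hx : ∀ i, x i ∈ Icc lo hi) (k : Fin N) :
    rankPay lo hi μ f x k = if 0 ≤ marginalRevenue μ f x then
      if k = 0 then threshold lo hi μ f (orderStat x 2) - orderStat x 2
      else if k = 1 then threshold lo hi μ f (orderStat x 2) else 0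
    else 0 := by
  by_cases hneg : virtualValue μ f (orderStat x 2) < 0
  · simp only [rankPay, if_pos hneg]
  have heq : threshold lo hi μ f (orderStat x 2) = orderStat x 2 :=
    h.threshold_eq_self hlo (hx _) (not_lt.1 hneg)
  have h01 : (0 : Fin N) ≠ 1 := fun h01 => by simpa [← h01] using val_one_of_three_le hN
  rcases eq_or_ne k 0 with rfl | hk
  · simp only [rankPay, if_neg hneg, heq, sub_self, if_neg h01, if_pos]
  · simp only [rankPay, if_neg hneg, heq, if_neg hk]

lemma rankPay_mem_Icc (h : IsPriorDensity lo hi μ f) (hlo : 0 ≤ lo) (hN : 3 ≤ N)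
    (hx : ∀ i, x i ∈ Icc lo hi) (k : Fin N) : rankPay lo hi μ f x k ∈ Icc 0 hi := by
  have hx2 : orderStat x 2 ∈ Icc lo hi := hx _
  obtain ⟨⟨-, hle_hi⟩, hle, -⟩ := (h.isLeast_threshold hlo hx2.2).1
  have hhi : 0 ≤ hi := hlo.trans h.lo_lt_hi.le
  rw [h.rankPay_eq hlo hN hx]
  split_ifs <;> constructor <;> linarith [hx2.1]

lemma integrable_secondBidderMechanism_pay {g : (Fin N → ℝ) → Fin N → ℝ}
    (h : IsPriorDensity lo hi μ f) (hlo : 0 ≤ lo) (hN : 3 ≤ N) (i : Fin N) (hg : Measurable g)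
    (hmem : ∀ᵐ y ∂(jointLaw N μ), ∀ j, g y j ∈ Icc lo hi) :
    Integrable (fun y => (secondBidderMechanism N lo hi μ f).pay (g y) i) (jointLaw N μ) := by
  refine .of_mem_Icc 0 hi
    ((measurable_rankAverage (h.measurable_rankPay hlo) i).comp hg).aemeasurable ?_
  filter_upwards [hmem] with y hy
  exact rankAverage_mem_Icc (h.rankPay_mem_Icc hlo hN hy) i

end IsPriorDensity

namespace IsTopThree

variable {p s t : Fin N}

lemma secondBidderMechanism_alloc_eq (ht : IsTopThree x p s t) (hN : 3 ≤ N)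
    (hx : Function.Injective x) (j : Fin N) : (secondBidderMechanism N lo hi μ f).alloc x j
      = if 0 ≤ marginalRevenue μ f x ∧ j = s then 1 else 0 := by
  obtain ⟨-, rfl, -⟩ := ht.eq_sortedRanking hN hx
  simp only [secondBidderMechanism_alloc, rankAverage_of_injective hx, rankAlloc,
    Equiv.Perm.inv_eq_iff_eq]

variable [IsProbabilityMeasure μ]

lemma secondBidderMechanism_pay_eq (ht : IsTopThree x p s t) (h : IsPriorDensity lo hi μ f)
    (hlo : 0 ≤ lo) (hN : 3 ≤ N) (hx : Function.Injective x) (hmem : ∀ i, x i ∈ Icc lo hi)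
    (j : Fin N) : (secondBidderMechanism N lo hi μ f).pay x j
      = if 0 ≤ marginalRevenue μ f x then
          if j = p then threshold lo hi μ f (x t) - x t
          else if j = s then threshold lo hi μ f (x t) else 0
        else 0 := by
  obtain ⟨rfl, rfl, rfl⟩ := ht.eq_sortedRanking hN hx
  simp only [secondBidderMechanism_pay, rankAverage_of_injective hx, h.rankPay_eq hlo hN hmem,
    Equiv.Perm.inv_eq_iff_eq, orderStat_eq]

lemma marginalRevenue_nonneg_iff (ht : IsTopThree x p s t) (h : IsPriorDensity lo hi μ f)
    (hlo : 0 ≤ lo) (hψ : MonotoneOn (virtualValue μ f) (Icc lo hi)) (hN : 3 ≤ N)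
    (hx : Function.Injective x) (hs : x s ∈ Icc lo hi) :
    0 ≤ marginalRevenue μ f x ↔ threshold lo hi μ f (x t) ≤ x s := by
  rw [ht.marginalRevenue_eq hN hx, h.threshold_le_iff hlo hψ hs ht.third_lt_second.le]

end IsTopThree

end SecondBidder

section Rivals

variable {y : Fin N → ℝ} {S : Finset (Fin N)} {i a m n : Fin N}

lemma secondAuctionPayoff_update_eq_max (hi : i ∉ S) (ha : a ∈ S) (h0 : 0 ≤ y a)
    (hle : ∀ k ∈ S, y k ≤ y a) (x : ℝ) :
    secondAuctionPayoff (Function.update y i x) S i = max (x - y a) 0 := by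
  rw [secondAuctionPayoff, fold_max_update hi, Function.update_self,
    fold_max_eq_of_forall_le ha h0 hle]

namespace IsTopTwo

lemma secondAuctionPayoff_update (h : IsTopTwo y S m n) (hi : i ∉ S) (h0 : 0 ≤ y m) (x : ℝ) :
    secondAuctionPayoff (Function.update y i x) S i = max (x - y m) 0 :=
  secondAuctionPayoff_update_eq_max hi h.first_mem h0 (fun _ => h.le_first) x

lemma secondAuctionPayoff_update_erase_first (h : IsTopTwo y S m n) (hi : i ∉ S) (h0 : 0 ≤ y n)
    (x : ℝ) : secondAuctionPayoff (Function.update y i x) (S.erase m) i = max (x - y n) 0 :=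
  secondAuctionPayoff_update_eq_max (fun hi' => hi (Finset.mem_of_mem_erase hi'))
    (Finset.mem_erase.2 ⟨h.first_ne_second.symm, h.second_mem⟩) h0
    (fun k hk => h.le_second k (Finset.mem_of_mem_erase hk) (Finset.ne_of_mem_erase hk)) x

lemma secondAuctionPayoff_update_erase_second (h : IsTopTwo y S m n) (hi : i ∉ S) (h0 : 0 ≤ y m)
    (x : ℝ) : secondAuctionPayoff (Function.update y i x) (S.erase n) i = max (x - y m) 0 :=
  secondAuctionPayoff_update_eq_max (fun hi' => hi (Finset.mem_of_mem_erase hi'))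
    (Finset.mem_erase.2 ⟨h.first_ne_second, h.first_mem⟩) h0
    (fun _ hk => h.le_first (Finset.mem_of_mem_erase hk)) x

end IsTopTwo

end Rivals

section ExPost

/-- Payoff in the second-highest-bidder mechanism of a buyer with valuation `x` who reports `q`,
when the two highest rival reports are `r₁` and `r₂` and the threshold at `r₂` is `a`. -/
def exPostPayoff (a r₁ r₂ q x : ℝ) : ℝ :=
  if r₁ < q then if a ≤ r₁ then max (x - r₂) 0 - (a - r₂) else max (x - r₁) 0
  else if r₂ < q ∧ a ≤ q then x - a else max (x - r₁) 0

variable {a r₁ r₂ : ℝ}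

-- Counting both sellers, a buyer can get a good at the price `min a r₁`, whatever he reports.
lemma exPostPayoff_le (ha : r₂ ≤ a) (q x : ℝ) :
    exPostPayoff a r₁ r₂ q x ≤ max (x - min a r₁) 0 := by
  have hthr : x - a ≤ x - min a r₁ := sub_le_sub_left (min_le_left a r₁) x
  have hrival : max (x - r₁) 0 ≤ max (x - min a r₁) 0 :=
    max_le_max_right 0 (sub_le_sub_left (min_le_right a r₁) x)
  rw [exPostPayoff]
  split_ifs
  · rw [sub_le_iff_le_add]
    refine max_le ?_ ?_ <;> linarith [le_max_left (x - min a r₁) 0, le_max_right (x - min a r₁) 0]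
  · exact hrival
  · exact hthr.trans (le_max_left _ _)
  · exact hrival

lemma exPostPayoff_self (ha : r₂ ≤ a) (x : ℝ) :
    exPostPayoff a r₁ r₂ x x = max (x - min a r₁) 0 := by
  rw [exPostPayoff]
  split_ifs with hr₁ har₁ hwin
  · rw [min_eq_left har₁, max_eq_left (by linarith), max_eq_left (by linarith)]
    ring
  · rw [min_eq_right (not_le.1 har₁).le]
  · rw [min_eq_left (hwin.2.trans (not_lt.1 hr₁)), max_eq_left (sub_nonneg.2 hwin.2)]
  · have hxa : x ≤ a := by
      by_contra! hlt
      exact hwin ⟨ha.trans_lt hlt, hlt.le⟩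
    rw [max_eq_right (sub_nonpos.2 (not_lt.1 hr₁)),
      max_eq_right (sub_nonpos.2 (le_min hxa (not_lt.1 hr₁)))]

/-- Payoff of buyer `i` net of his payment, when the valuations are `v` and the reports `b`. -/
def DirectMechanism.netPayoff (M : DirectMechanism N) (v b : Fin N → ℝ) (i : Fin N) : ℝ :=
  M.grossPayoff v b i - M.pay b i

lemma DirectMechanism.interimPayoff_eq_integral_netPayoff (M : DirectMechanism N) (μ : Measure ℝ)
    (i : Fin N) (q x : ℝ) : M.interimPayoff μ i q x
      = ∫ y, M.netPayoff (Function.update y i x) (Function.update y i q) i ∂(jointLaw N μ) := rfl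

variable [NeZero N] {lo hi : ℝ} {μ : Measure ℝ} [IsProbabilityMeasure μ] {f : ℝ → ℝ}
  {b y : Fin N → ℝ} {p s t i m n : Fin N}

namespace IsTopThree

lemma netPayoff_first (ht : IsTopThree b p s t) (h : IsPriorDensity lo hi μ f) (hlo : 0 ≤ lo)
    (hψ : MonotoneOn (virtualValue μ f) (Icc lo hi)) (hN : 3 ≤ N) (hb : Function.Injective b)
    (hmem : ∀ i, b i ∈ Icc lo hi) (v : Fin N → ℝ) :
    (secondBidderMechanism N lo hi μ f).netPayoff v b p
      = if threshold lo hi μ f (b t) ≤ b s then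
          secondAuctionPayoff v ((Finset.univ.erase p).erase s) p
            - (threshold lo hi μ f (b t) - b t)
        else secondAuctionPayoff v (Finset.univ.erase p) p := by
  have hps := ht.first_ne_second
  simp only [DirectMechanism.netPayoff, DirectMechanism.grossPayoff,
    ht.secondBidderMechanism_alloc_eq hN hb, ht.secondBidderMechanism_pay_eq h hlo hN hb hmem,
    ht.marginalRevenue_nonneg_iff h hlo hψ hN hb (hmem s)]
  by_cases hle : threshold lo hi μ f (b t) ≤ b s <;> simp [hle, hps, hps.symm]

lemma netPayoff_second (ht : IsTopThree b p s t) (h : IsPriorDensity lo hi μ f) (hlo : 0 ≤ lo)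
    (hψ : MonotoneOn (virtualValue μ f) (Icc lo hi)) (hN : 3 ≤ N) (hb : Function.Injective b)
    (hmem : ∀ i, b i ∈ Icc lo hi) (v : Fin N → ℝ) :
    (secondBidderMechanism N lo hi μ f).netPayoff v b s
      = if threshold lo hi μ f (b t) ≤ b s then v s - threshold lo hi μ f (b t)
        else secondAuctionPayoff v (Finset.univ.erase s) s := by
  have hps := ht.first_ne_second
  simp only [DirectMechanism.netPayoff, DirectMechanism.grossPayoff,
    ht.secondBidderMechanism_alloc_eq hN hb, ht.secondBidderMechanism_pay_eq h hlo hN hb hmem,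
    ht.marginalRevenue_nonneg_iff h hlo hψ hN hb (hmem s)]
  by_cases hle : threshold lo hi μ f (b t) ≤ b s <;> simp [hle, hps.symm]

lemma netPayoff_of_ne (ht : IsTopThree b p s t) (h : IsPriorDensity lo hi μ f) (hlo : 0 ≤ lo)
    (hψ : MonotoneOn (virtualValue μ f) (Icc lo hi)) (hN : 3 ≤ N) (hb : Function.Injective b)
    (hmem : ∀ i, b i ∈ Icc lo hi) (v : Fin N → ℝ) (hip : i ≠ p) (his : i ≠ s) :
    (secondBidderMechanism N lo hi μ f).netPayoff v b i
      = if threshold lo hi μ f (b t) ≤ b s then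
          secondAuctionPayoff v ((Finset.univ.erase i).erase s) i
        else secondAuctionPayoff v (Finset.univ.erase i) i := by
  simp only [DirectMechanism.netPayoff, DirectMechanism.grossPayoff,
    ht.secondBidderMechanism_alloc_eq hN hb, ht.secondBidderMechanism_pay_eq h hlo hN hb hmem,
    ht.marginalRevenue_nonneg_iff h hlo hψ hN hb (hmem s)]
  by_cases hle : threshold lo hi μ f (b t) ≤ b s <;> simp [hle, hip, his, his.symm]

end IsTopThree

lemma IsTopTwo.netPayoff_update_eq (hr : IsTopTwo y (Finset.univ.erase i) m n)
    (h : IsPriorDensity lo hi μ f) (hlo : 0 ≤ lo)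
    (hψ : MonotoneOn (virtualValue μ f) (Icc lo hi)) (hN : 3 ≤ N) (hinj : Function.Injective y)
    (hy : ∀ j, y j ∈ Icc lo hi) {q : ℝ} (hq : q ∈ Icc lo hi) (hyq : ∀ j, y j ≠ q) (x : ℝ) :
    (secondBidderMechanism N lo hi μ f).netPayoff (Function.update y i x) (Function.update y i q) i
      = exPostPayoff (threshold lo hi μ f (y n)) (y m) (y n) q x := by
  have hb := update_injective hinj i hyq
  have hmem := update_mem hy i hq
  have h0 : ∀ k, 0 ≤ y k := fun k => hlo.trans (hy k).1
  have hi : i ∉ Finset.univ.erase i := Finset.notMem_erase _ _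
  have hmi : m ≠ i := Finset.ne_of_mem_erase hr.first_mem
  have hni : n ≠ i := Finset.ne_of_mem_erase hr.second_mem
  rw [exPostPayoff]
  rcases (hyq m).lt_or_gt with hmq | hqm
  · rw [(hr.isTopThree_update_of_first_lt hmq).netPayoff_first h hlo hψ hN hb hmem, if_pos hmq,
      Function.update_of_ne hmi, Function.update_of_ne hni,
      hr.secondAuctionPayoff_update_erase_first hi (h0 n), hr.secondAuctionPayoff_update hi (h0 m)]
  rw [if_neg hqm.not_gt]
  rcases (hyq n).lt_or_gt with hnq | hqn
  · have ht := hr.isTopThree_update_of_second_lt_of_lt_first hnq hqm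
    rw [ht.netPayoff_second h hlo hψ hN hb hmem,
      Function.update_of_ne hni, Function.update_self, Function.update_self,
      hr.secondAuctionPayoff_update hi (h0 m)]
    simp only [hnq, true_and]
  · obtain ⟨t, ht⟩ := hr.exists_isTopThree_update_of_lt_second hb hqn
    rw [ht.netPayoff_of_ne h hlo hψ hN hb hmem _ hmi.symm hni.symm,
      hr.secondAuctionPayoff_update_erase_second hi (h0 m), hr.secondAuctionPayoff_update hi (h0 m),
      ite_self, if_neg fun hwin => hqn.not_gt hwin.1]

end ExPost

section Optimality

variable {lo hi : ℝ} {μ : Measure ℝ} [IsProbabilityMeasure μ] {f : ℝ → ℝ}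

lemma ae_exists_isTopTwo [NullSingletonClass μ] (hN : 3 ≤ N) (i : Fin N) :
    ∀ᵐ y ∂(jointLaw N μ), ∃ m n, IsTopTwo y (Finset.univ.erase i) m n := by
  filter_upwards [ae_injective] with y hy
  refine exists_isTopTwo hy (Finset.one_lt_card_iff_nontrivial.1 ?_)
  rw [Finset.card_erase_of_mem (Finset.mem_univ i), Finset.card_fin]
  lia

lemma integrable_secondAuctionPayoff_update (S : Finset (Fin N)) (i : Fin N) {x : ℝ}
    (hx : 0 ≤ x) :
    Integrable (fun y => secondAuctionPayoff (Function.update y i x) S i) (jointLaw N μ) := by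
  refine .of_mem_Icc 0 x ((measurable_secondAuctionPayoff S i).comp
    measurable_update_left).aemeasurable (.of_forall fun y => ?_)
  have hmem : secondAuctionPayoff (Function.update y i x) S i ∈ Icc 0 (Function.update y i x i) :=
    secondAuctionPayoff_mem_Icc (by rwa [Function.update_self])
  rwa [Function.update_self] at hmem

namespace IsPriorDensity

variable [NeZero N]

lemma integrable_secondBidderMechanism_pay_update (h : IsPriorDensity lo hi μ f) (hlo : 0 ≤ lo)
    (hN : 3 ≤ N) (i : Fin N) {q : ℝ} (hq : q ∈ Icc lo hi) :
    Integrable (fun y => (secondBidderMechanism N lo hi μ f).pay (Function.update y i q) i)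
      (jointLaw N μ) :=
  h.integrable_secondBidderMechanism_pay hlo hN i measurable_update_left <|
    (ae_forall_mem_Icc h.ae_mem_Icc).mono fun _ hy => update_mem hy i hq

lemma integrable_secondBidderMechanism_netPayoff (h : IsPriorDensity lo hi μ f) (hlo : 0 ≤ lo)
    (hN : 3 ≤ N) (i : Fin N) {q x : ℝ} (hq : q ∈ Icc lo hi) (hx : 0 ≤ x) :
    Integrable (fun y => (secondBidderMechanism N lo hi μ f).netPayoff (Function.update y i x)
      (Function.update y i q) i) (jointLaw N μ) :=
  (h.isFeasible_secondBidderMechanism.integrable_grossPayoff_update h.ae_mem_Icc i hq hx).sub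
    (h.integrable_secondBidderMechanism_pay_update hlo hN i hq)

lemma ae_netPayoff_eq_exPostPayoff (h : IsPriorDensity lo hi μ f) (hlo : 0 ≤ lo)
    (hψ : MonotoneOn (virtualValue μ f) (Icc lo hi)) (hN : 3 ≤ N) (i : Fin N) {q : ℝ}
    (hq : q ∈ Icc lo hi) :
    ∀ᵐ y ∂(jointLaw N μ), ∀ m n, IsTopTwo y (Finset.univ.erase i) m n → ∀ x,
      (secondBidderMechanism N lo hi μ f).netPayoff (Function.update y i x)
        (Function.update y i q) i = exPostPayoff (threshold lo hi μ f (y n)) (y m) (y n) q x := by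
  have := h.nullSingletonClass
  filter_upwards [ae_forall_mem_Icc h.ae_mem_Icc, ae_injective, ae_forall_ne q]
    with y hy hinj hyq m n hr x
  exact hr.netPayoff_update_eq h hlo hψ hN hinj hy hq hyq x

lemma isAdmissible_secondBidderMechanism (h : IsPriorDensity lo hi μ f) (hlo : 0 ≤ lo)
    (hψ : MonotoneOn (virtualValue μ f) (Icc lo hi)) (hN : 3 ≤ N) :
    (secondBidderMechanism N lo hi μ f).IsAdmissible lo hi μ where
  measurable_alloc := h.isFeasible_secondBidderMechanism.measurable_alloc
  measurable_pay := measurable_rankAverage (h.measurable_rankPay hlo)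
  integrable_pay i := h.integrable_secondBidderMechanism_pay hlo hN i measurable_id
    (ae_forall_mem_Icc h.ae_mem_Icc)
  integrable_interim_pay i _ hq := h.integrable_secondBidderMechanism_pay_update hlo hN i hq
  alloc_nonneg x _ := (feasibleAt_secondBidderMechanism x).1
  alloc_sum_le_one x _ := (feasibleAt_secondBidderMechanism x).2
  incentive_compatible i x hx q hq := by
    have := h.nullSingletonClass
    have hx0 := hlo.trans hx.1
    simp only [DirectMechanism.interimPayoff_eq_integral_netPayoff]
    refine integral_mono_ae (h.integrable_secondBidderMechanism_netPayoff hlo hN i hq hx0)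
      (h.integrable_secondBidderMechanism_netPayoff hlo hN i hx hx0) ?_
    filter_upwards [ae_forall_mem_Icc h.ae_mem_Icc, ae_exists_isTopTwo hN i,
      h.ae_netPayoff_eq_exPostPayoff hlo hψ hN i hq, h.ae_netPayoff_eq_exPostPayoff hlo hψ hN i hx]
      with y hy ⟨m, n, hr⟩ hdev htruth
    have ha := h.le_threshold hlo (hy n).2
    rw [hdev m n hr, htruth m n hr, exPostPayoff_self ha]
    exact exPostPayoff_le ha q x
  individually_rational i x hx := by
    have := h.nullSingletonClass
    have hx0 := hlo.trans hx.1
    rw [outsideOption, DirectMechanism.interimPayoff_eq_integral_netPayoff]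
    refine integral_mono_ae (integrable_secondAuctionPayoff_update _ i hx0)
      (h.integrable_secondBidderMechanism_netPayoff hlo hN i hx hx0) ?_
    filter_upwards [ae_forall_mem_Icc h.ae_mem_Icc, ae_exists_isTopTwo hN i,
      h.ae_netPayoff_eq_exPostPayoff hlo hψ hN i hx] with y hy ⟨m, n, hr⟩ htruth
    rw [htruth m n hr, exPostPayoff_self (h.le_threshold hlo (hy n).2),
      hr.secondAuctionPayoff_update (Finset.notMem_erase i _) (hlo.trans (hy m).1)]
    exact max_le_max_right 0 (sub_le_sub_left (min_le_right _ _) x)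

lemma interimPayoff_secondBidderMechanism_lo (h : IsPriorDensity lo hi μ f) (hlo : 0 ≤ lo)
    (hψ : MonotoneOn (virtualValue μ f) (Icc lo hi)) (hN : 3 ≤ N) (i : Fin N) :
    (secondBidderMechanism N lo hi μ f).interimPayoff μ i lo lo = outsideOption N μ i lo := by
  have := h.nullSingletonClass
  rw [outsideOption, DirectMechanism.interimPayoff_eq_integral_netPayoff]
  refine integral_congr_ae ?_
  filter_upwards [ae_forall_mem_Icc h.ae_mem_Icc, ae_exists_isTopTwo hN i,
    h.ae_netPayoff_eq_exPostPayoff hlo hψ hN i (left_mem_Icc.2 h.lo_lt_hi.le)]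
    with y hy ⟨m, n, hr⟩ htruth
  have ha := h.le_threshold hlo (hy n).2
  have hprice : lo ≤ min (threshold lo hi μ f (y n)) (y m) :=
    le_min ((hy n).1.trans ha) (hy m).1
  rw [htruth m n hr, exPostPayoff_self ha,
    hr.secondAuctionPayoff_update (Finset.notMem_erase i _) (hlo.trans (hy m).1),
    max_eq_right (sub_nonpos.2 hprice), max_eq_right (sub_nonpos.2 (hy m).1)]

lemma revenue_secondBidderMechanism (h : IsPriorDensity lo hi μ f) (hlo : 0 ≤ lo)
    (hψ : MonotoneOn (virtualValue μ f) (Icc lo hi)) (hN : 3 ≤ N) :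
    (secondBidderMechanism N lo hi μ f).revenue μ
      = ∫ x, max (marginalRevenue μ f x) 0 ∂(jointLaw N μ) := by
  have := h.nullSingletonClass
  rw [(h.isAdmissible_secondBidderMechanism hlo hψ hN).revenue_eq hlo h]
  simp only [h.interimPayoff_secondBidderMechanism_lo hlo hψ hN, sub_self, Finset.sum_const_zero,
    sub_zero]
  refine integral_congr_ae ?_
  filter_upwards [ae_forall_mem_Icc h.ae_mem_Icc, ae_injective] with x hx hinj
  simp only [(isTopThree_sortedRanking hN hinj).secondBidderMechanism_alloc_eq hN hinj]
  by_cases hmr : 0 ≤ marginalRevenue μ f x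
  · simp [hmr, virtualGain_sortedRanking_one hN hinj fun k => hlo.trans (hx k).1]
  · simp [hmr, (not_le.1 hmr).le]

end IsPriorDensity

end Optimality

end SeqAuction

end

theorem theorem1 (N : ℕ) [NeZero N] (hN : 3 ≤ N)
    (lo hi : ℝ) (hlo : 0 ≤ lo) (hlohi : lo < hi)
    -- the law `F` of one valuation, with a continuous density `f` on its support `[lo, hi]`
    (μ : Measure ℝ) [IsProbabilityMeasure μ] (f : ℝ → ℝ)
    (hμ : μ = volume.withDensity fun x => ENNReal.ofReal (f x))
    (hf_zero : ∀ x, x ∉ Icc lo hi → f x = 0)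
    (hf_cont : ContinuousOn f (Icc lo hi))
    (hf_pos : ∀ x ∈ Ico lo hi, 0 < f x)
    -- increasing virtual values
    (hψ : MonotoneOn (SeqAuction.virtualValue μ f) (Icc lo hi)) :
    -- the minimum that defines `a(x)` exists
    (∀ x ∈ Icc lo hi, IsLeast (SeqAuction.thresholdSet lo hi μ f x)
      (SeqAuction.threshold lo hi μ f x)) ∧
    -- for all reports: the good is allocated iff `x₍₂₎ ≥ a(x₍₃₎)`, and the stated payments
    -- are positive in each of the two cases
    (∀ x : Fin N → ℝ, (∀ i, x i ∈ Icc lo hi) →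
      (0 ≤ SeqAuction.marginalRevenue μ f x ↔
        SeqAuction.threshold lo hi μ f (SeqAuction.orderStat x 2) ≤ SeqAuction.orderStat x 1) ∧
      (SeqAuction.virtualValue μ f (SeqAuction.orderStat x 2) < 0 →
        0 < SeqAuction.threshold lo hi μ f (SeqAuction.orderStat x 2) - SeqAuction.orderStat x 2 ∧
        0 < SeqAuction.threshold lo hi μ f (SeqAuction.orderStat x 2)) ∧
      (0 ≤ SeqAuction.virtualValue μ f (SeqAuction.orderStat x 2) →
        0 ≤ SeqAuction.marginalRevenue μ f x ∧
        SeqAuction.threshold lo hi μ f (SeqAuction.orderStat x 2) = SeqAuction.orderStat x 2 ∧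
        0 < SeqAuction.orderStat x 2)) ∧
    -- the mechanism is optimal
    (SeqAuction.secondBidderMechanism N lo hi μ f).IsOptimal lo hi μ ∧
    -- its expected revenue
    Integrable (fun x => max (SeqAuction.marginalRevenue μ f x) 0) (SeqAuction.jointLaw N μ) ∧
    (SeqAuction.secondBidderMechanism N lo hi μ f).revenue μ =
      ∫ x, max (SeqAuction.marginalRevenue μ f x) 0 ∂(SeqAuction.jointLaw N μ) := by
  have h : SeqAuction.IsPriorDensity lo hi μ f := ⟨hlohi, hμ, hf_zero, hf_cont, hf_pos⟩
  have hadm := h.isAdmissible_secondBidderMechanism hlo hψ hN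
  have hrev := h.revenue_secondBidderMechanism hlo hψ hN
  refine ⟨fun x hx => h.isLeast_threshold hlo hx.2, fun x hx => ?_,
    ⟨hadm, fun M hM => (hM.revenue_le hlo h hψ hN).trans_eq hrev.symm⟩,
    h.integrable_max_marginalRevenue hlo, hrev⟩
  have h1 : SeqAuction.orderStat x 1 ∈ Icc lo hi := hx _
  have h2 : SeqAuction.orderStat x 2 ∈ Icc lo hi := hx _
  have h21 := SeqAuction.orderStat_two_le_orderStat_one hN x
  refine ⟨(h.threshold_le_iff hlo hψ h1 h21).symm, fun hneg => ?_, fun hnonneg => ?_⟩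
  · have hlt := h.lt_threshold hlo h2.2 hneg
    exact ⟨sub_pos.2 hlt, (hlo.trans h2.1).trans_lt hlt⟩
  · have hself := h.threshold_eq_self hlo h2 hnonneg
    exact ⟨(h.threshold_le_iff hlo hψ h1 h21).1 (hself.trans_le h21), hself,
      h.pos_of_virtualValue_nonneg hlo h2 hnonneg⟩
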